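/- Let $\mathbb T=\mathbb R/\mathbb Z$, let $|\cdot|$ be the supremum norm, and for $R>0$ let $B_R=\{I\in\mathbb R^2: |I|\le R\}$. For an integer $n\ge 0$ and a domain $D$ in $\mathbb R^2$ (action variables $I$) or in $\mathbb T^2\times\mathbb R^2$ (variables $(\theta,I)$), let $|\cdot|_{C^n(D)}$ be the supremum over $D$ of the absolute values of all partial derivatives of order at most $n$; $C^n_1(D)$ is the closed unit ball of $C^n(D)$ for this norm. Functions of class $C^n$ on a closed domain are $C^n$ up to the boundary. Let $r$ be an integer and let $R>0$, $L\ge 0$, $\varpi>0$. There are constants $\kappa,\varepsilon_0,C>0$, depending only on $r,R,L,\varpi$, such that the following holds. Let $l,l'\ge 1$ be integers with $r\ge 2(l+1)+3$ and $l\ge 2(l'+1)+3$. Let $h\in C^{l+3}_1(B_R)$, $f\in C^r_1(\mathbb T^2\times B_R)$, and assume that there are closed segments $S_1^*\subseteq S_1\subseteq[-R,R]$, with $S_1^*$ of length $L$, such that $$\partial_{I_1}h(I_1,0)=0\ \ (I_1\in S_1),\qquad \partial_{I_2}h(I_1,0)\ge\varpi\ \ (I_1\in S_1^*).$$ Put $S^*=S_1^*\times\{0\}$,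 $S^*(\rho)=\{I\in\mathbb R^2: d(I,S^*)\le\rho\}$ for the distance $d$ of the supremum norm, $\mathcal D^*(\rho)=\mathbb T^2\times S^*(\rho)$, and for a function $g$ of $(\theta,I)$ let $\bar g(\theta_1,I)=\int_{\mathbb T}g(\theta_1,\theta_2,I)\,d\theta_2$. Let $0<\varepsilon\le\varepsilon_0$ be such that $S^*(\kappa\varepsilon)\subseteq B_R$, and let $H=h+\varepsilon f$. Then there exist a symplectic embedding $\Phi_1:\mathcal D^*(\kappa\varepsilon/2)\to\mathcal D^*(\kappa\varepsilon)$ of class $C^{l+1}$ and a function $f'\in C^l(\mathcal D^*(\kappa\varepsilon/2))$ with $$H\circ\Phi_1=h+\varepsilon\bar f+\varepsilon^2f',\qquad |\Phi_1-\mathrm{Id}|_{C^0}\le\kappa\varepsilon/2,\qquad |f'|_{C^l(\mathcal D^*(\kappa\varepsilon/2))}\le C,$$ and, for this $f'$, a symplectic embedding $\Phi:\mathcal D^*(\kappa\varepsilon/4)\to\mathcal D^*(\kappa\varepsilon)$ of class $C^{l'+1}$ and a function $f''\in C^{l'}(\mathcal D^*(\kappa\varepsilon/4))$ with $$H\circ\Phi=h+\varepsilon\bar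 f+\varepsilon^2\bar f'+\varepsilon^3f'',\qquad |\Phi-\mathrm{Id}|_{C^0}\le 3\kappa\varepsilon/4,\qquad |f''|_{C^{l'}(\mathcal D^*(\kappa\varepsilon/4))}\le C.$$ -/

import Mathlib

open scoped ENNReal

namespace TwoStepNormalForm

/-- ActionSpace space, `Fin 2 → ℝ` with the supremum norm (index `0` is `I₁`, index `1` is `I₂`). -/
abbrev ActionSpace : Type := Fin 2 → ℝ

/-- The universal cover `ℝ² × ℝ²` of the phase space `𝕋² × ℝ²`, with points `(θ, I)` and the
supremum norm.  Functions and maps on `𝕋² × S` are handled through their lifts to `ℝ² × S`. -/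
abbrev PhaseSpace : Type := (Fin 2 → ℝ) × (Fin 2 → ℝ)

/-- The coordinate vectors of the action space. -/
def actionBasis (i : Fin 2) : ActionSpace := Pi.single i 1

/-- The coordinate vectors of the phase space: two angles, then two actions. -/
def phaseBasis : Fin 2 ⊕ Fin 2 → PhaseSpace
  | Sum.inl i => (Pi.single i 1, 0)
  | Sum.inr i => (0, Pi.single i 1)

/-- The `C^n` norm on `s`: the supremum over `x ∈ s` and over all partial derivatives `∂^j` of
order at most `n`, along the coordinate vectors `e`, of `|∂^j f (x)|`.  It takes the value `∞`
if this is unbounded. Derivatives are taken within `s`, a closed set with unique derivatives. -/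
noncomputable def cNorm {ι E : Type} [NormedAddCommGroup E] [NormedSpace ℝ E]
    (e : ι → E) (n : ℕ) (s : Set E) (f : E → ℝ) : ℝ≥0∞ :=
  ⨆ (m : ℕ) (_ : m ≤ n) (j : Fin m → ι) (x : E) (_ : x ∈ s),
    ‖iteratedFDerivWithin ℝ m f s x (fun i => e (j i))‖ₑ

/-- The lattice vector `(k, 0)` by which angles are identified. -/
def latticeVec (k : Fin 2 → ℤ) : PhaseSpace := (fun i => (k i : ℝ), 0)

/-- The lift of `𝕋² × S` to `ℝ² × ℝ²`. -/
def torusTimes (S : Set ActionSpace) : Set PhaseSpace := Set.univ ×ˢ S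

/-- `f` is (the lift of) a function on `𝕋² × S`. -/
def IsPeriodic (S : Set ActionSpace) (f : PhaseSpace → ℝ) : Prop :=
  ∀ x ∈ torusTimes S, ∀ k : Fin 2 → ℤ, f (x + latticeVec k) = f x

/-- `h` is of class `C^n` on `S`, up to the boundary, with `C^n` norm at most `M`. -/
def IsActionCn (n : ℕ) (S : Set ActionSpace) (M : ℝ) (h : ActionSpace → ℝ) : Prop :=
  ContDiffOn ℝ n h S ∧ cNorm actionBasis n S h ≤ ENNReal.ofReal M

/-- `f` is a function of class `C^n` on `𝕋² × S`, up to the boundary, with `C^n` norm at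
most `M`. -/
def IsPhaseCn (n : ℕ) (S : Set ActionSpace) (M : ℝ) (f : PhaseSpace → ℝ) : Prop :=
  IsPeriodic S f ∧ ContDiffOn ℝ n f (torusTimes S) ∧
    cNorm phaseBasis n (torusTimes S) f ≤ ENNReal.ofReal M

/-- The closed ball `B_R` of radius `R` in action space, for the supremum norm. -/
def actionBall (R : ℝ) : Set ActionSpace := Metric.closedBall 0 R

/-- The frequency `ω_i(I) = ∂h/∂I_i (I)` of `h : B_R → ℝ`. -/
noncomputable def frequency (R : ℝ) (h : ActionSpace → ℝ) (i : Fin 2) (I : ActionSpace) : ℝ :=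
  fderivWithin ℝ h (actionBall R) I (actionBasis i)

/-- The segment `{(I₁, 0) : a ≤ I₁ ≤ b}` in action space. -/
def actionSegment (a b : ℝ) : Set ActionSpace := {I | I 0 ∈ Set.Icc a b ∧ I 1 = 0}

/-- The closed `ρ`-neighbourhood `S^*(ρ)` of the segment `S^* = [a, b] × {0}`, for the distance
of the supremum norm. -/
def segmentNhd (a b ρ : ℝ) : Set ActionSpace := Metric.cthickening ρ (actionSegment a b)

/-- The `θ₂`-average `∫_𝕋 f(θ₁, θ₂, I) dθ₂`. -/
noncomputable def average (f : PhaseSpace → ℝ) (x : PhaseSpace) : ℝ :=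
  ∫ t in (0 : ℝ)..1, f (![x.1 0, t], x.2)

/-- The canonical symplectic form `dθ₁ ∧ dI₁ + dθ₂ ∧ dI₂`. -/
def symplecticForm (u v : PhaseSpace) : ℝ := ∑ i, (u.1 i * v.2 i - u.2 i * v.1 i)

/-- `Φ` is the lift of a symplectic embedding `𝕋² × S → 𝕋² × S'` of class `C^n`, homotopic to
the inclusion on the angles. For compact `S` (the only case used) an injective continuous map on
`𝕋² × S` is a homeomorphism onto its image, and a symplectic map is an immersion. -/
structure IsSymplecticEmbedding (n : ℕ) (S S' : Set ActionSpace) (Φ : PhaseSpace → PhaseSpace) : Prop where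
  mapsTo : Set.MapsTo Φ (torusTimes S) (torusTimes S')
  equivariant : ∀ x ∈ torusTimes S, ∀ k : Fin 2 → ℤ, Φ (x + latticeVec k) = Φ x + latticeVec k
  contDiffOn : ContDiffOn ℝ n Φ (torusTimes S)
  /-- injectivity as a map of `𝕋² × S` into `𝕋² × S'` -/
  injective : ∀ x ∈ torusTimes S, ∀ y ∈ torusTimes S,
    (∃ k : Fin 2 → ℤ, Φ y = Φ x + latticeVec k) → ∃ k : Fin 2 → ℤ, y = x + latticeVec k
  symplectic : ∀ x ∈ torusTimes S, ∀ u v : PhaseSpace,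
    symplecticForm (fderivWithin ℝ Φ (torusTimes S) x u) (fderivWithin ℝ Φ (torusTimes S) x v)
      = symplecticForm u v

/-- `|Φ - Id|_{C⁰} ≤ ρ` on `𝕋² × S`. -/
def IsCloseToId (S : Set ActionSpace) (ρ : ℝ) (Φ : PhaseSpace → PhaseSpace) : Prop :=
  ∀ x ∈ torusTimes S, ‖Φ x - x‖ ≤ ρ

/-- The Hamiltonian `H = h + ε f`. -/
def hamiltonian (h : ActionSpace → ℝ) (ε : ℝ) (f : PhaseSpace → ℝ) (x : PhaseSpace) : ℝ := h x.2 + ε * f x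

end TwoStepNormalForm

open TwoStepNormalForm

/-! The perturbation is averaged over the fast angle θ₂ twice, each time by an exactly symplectic
change of variables. The slow frequency ω₁ vanishes on the segment, so it is O(ε) on a neighbourhood
of width κε, while the fast frequency ω₂ stays above ϖ/2.

The homological equation ω · ∂_θ χ = f̄ - f is solved only approximately. After division by ω₂ the
operator is ∂_{θ₂} + (ω₁/ω₂) ∂_{θ₁}, and it is inverted by a Neumann series cut after n + 1 terms
(`generator`). The error telescopes to (-ω₁/ω₂)^(n+1) times a C^n function (`homological_equation`).
The ratio is O(ε) in C⁰ but only O(1) in C^n; since at most n derivatives cannot use up n + 1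
factors, the error is still O(ε) in C^n (`UnifCn.pow_succ_div`). Each term of the series costs one
θ₁-derivative of f, hence the loss of about half of the derivatives at each step.

The map p = P + δ ∂_q χ(q, P), Q = q + δ ∂_P χ(q, P) is exactly symplectic, costs one derivative of
χ, and is obtained by inverting in the angles alone (`exists_generated_map`). Expanding h at first
order produces the homological equation; all other changes are Hadamard quotients
(`exists_normalForm_step`). A term ε g already in normal form changes by O(δε) only. The theorem is
this step with δ = ε, g = 0, followed by the step with δ = ε², g = f̄ and perturbation f'.

Uniformity of the constants comes from working with families indexed by all admissible data
(`UnifCn`). The order of choice matters: M bounds the first generator on all data with ω₂ ≥ ϖ/2,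
independently of κ; then κ ≥ 16 M makes the displacement ε M small against κε; the bounds on ω₁/ε,
f' and the second generator may depend on κ, and ε₀ comes last. -/

namespace TwoStepNormalForm

/-! ### Calculus of families bounded uniformly in C^n. -/

variable {ι ι' E F G H : Type}
  [NormedAddCommGroup E] [NormedSpace ℝ E] [NormedAddCommGroup F] [NormedSpace ℝ F]
  [NormedAddCommGroup G] [NormedSpace ℝ G] [NormedAddCommGroup H] [NormedSpace ℝ H]

/-- A family of functions, each of class `C^n` on an open set, with all derivatives of order at
most `n` bounded uniformly over the family. -/
structure UnifCn (n : ℕ) (U : ι → Set E) (f : ι → E → F) : Prop where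
  isOpen : ∀ i, IsOpen (U i)
  contDiffOn : ∀ i, ContDiffOn ℝ n (f i) (U i)
  bound : ∃ M : ℝ, ∀ i, ∀ m ≤ n, ∀ x ∈ U i, ‖iteratedFDerivWithin ℝ m (f i) (U i) x‖ ≤ M

/-- As `UnifCn`, but the functions themselves may be unbounded. -/
structure UnifDerivCn (n : ℕ) (U : ι → Set E) (f : ι → E → F) : Prop where
  isOpen : ∀ i, IsOpen (U i)
  contDiffOn : ∀ i, ContDiffOn ℝ n (f i) (U i)
  bound : ∃ M : ℝ, ∀ i, ∀ m, 1 ≤ m → m ≤ n → ∀ x ∈ U i,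
    ‖iteratedFDerivWithin ℝ m (f i) (U i) x‖ ≤ M

variable {n m : ℕ} {U V : ι → Set E} {f g : ι → E → F}

theorem UnifCn.congr (hf : UnifCn n U f) (h : ∀ i, Set.EqOn (g i) (f i) (U i)) : UnifCn n U g := by
  refine ⟨hf.isOpen, fun i => (hf.contDiffOn i).congr (h i), ?_⟩
  obtain ⟨M, hM⟩ := hf.bound
  refine ⟨M, fun i m hm x hx => ?_⟩
  rw [iteratedFDerivWithin_congr (h i) hx]
  exact hM i m hm x hx

theorem UnifCn.mono_set (hf : UnifCn n U f) (hV : ∀ i, IsOpen (V i)) (h : ∀ i, V i ⊆ U i) :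
    UnifCn n V f := by
  refine ⟨hV, fun i => (hf.contDiffOn i).mono (h i), ?_⟩
  obtain ⟨M, hM⟩ := hf.bound
  refine ⟨M, fun i m hm x hx => ?_⟩
  rw [iteratedFDerivWithin_of_isOpen m (hV i) hx,
    ← iteratedFDerivWithin_of_isOpen m (hf.isOpen i) (h i hx)]
  exact hM i m hm x (h i hx)

theorem UnifCn.of_le (hf : UnifCn n U f) (h : m ≤ n) : UnifCn m U f := by
  refine ⟨hf.isOpen, fun i => (hf.contDiffOn i).of_le (by exact_mod_cast h), ?_⟩
  obtain ⟨M, hM⟩ := hf.bound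
  exact ⟨M, fun i k hk => hM i k (hk.trans h)⟩

theorem UnifCn.reindex (hf : UnifCn n U f) (σ : ι' → ι) :
    UnifCn n (fun i => U (σ i)) (fun i => f (σ i)) := by
  obtain ⟨M, hM⟩ := hf.bound
  exact ⟨fun i => hf.isOpen _, fun i => hf.contDiffOn _, M, fun i => hM _⟩

theorem UnifCn.unifDerivCn (hf : UnifCn n U f) : UnifDerivCn n U f := by
  obtain ⟨M, hM⟩ := hf.bound
  exact ⟨hf.isOpen, hf.contDiffOn, M, fun i m _ => hM i m⟩

theorem UnifCn.norm_le (hf : UnifCn n U f) : ∃ M > 0, ∀ i, ∀ x ∈ U i, ‖f i x‖ ≤ M := by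
  obtain ⟨M, hM⟩ := hf.bound
  refine ⟨max M 1, by positivity, fun i x hx => le_max_of_le_left ?_⟩
  simpa using hM i 0 (Nat.zero_le _) x hx

theorem UnifCn.differentiableAt (hf : UnifCn (n + 1) U f) {i : ι} {x : E} (hx : x ∈ U i) :
    DifferentiableAt ℝ (f i) x :=
  ((hf.contDiffOn i).differentiableOn (by simp)).differentiableAt ((hf.isOpen i).mem_nhds hx)

theorem UnifCn.continuousOn (hf : UnifCn n U f) (i : ι) : ContinuousOn (f i) (U i) :=
  (hf.contDiffOn i).continuousOn

theorem UnifCn.of_continuousOn (hU : ∀ i, IsOpen (U i)) (hf : ∀ i, ContinuousOn (f i) (U i))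
    {M : ℝ} (hM : ∀ i, ∀ x ∈ U i, ‖f i x‖ ≤ M) : UnifCn 0 U f := by
  refine ⟨hU, fun i => by simpa using hf i, M, fun i m hm x hx => ?_⟩
  obtain rfl : m = 0 := by omega
  simpa using hM i x hx

theorem norm_iteratedFDerivWithin_fderiv_of_isOpen {s : Set E} (hs : IsOpen s) {x : E}
    (hx : x ∈ s) (φ : E → F) (m : ℕ) :
    ‖iteratedFDerivWithin ℝ m (fderiv ℝ φ) s x‖ = ‖iteratedFDerivWithin ℝ (m + 1) φ s x‖ := by
  have h : Set.EqOn (fderivWithin ℝ φ s) (fderiv ℝ φ) s := fun y hy =>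
    fderivWithin_of_isOpen hs hy
  rw [← norm_iteratedFDerivWithin_fderivWithin hs.uniqueDiffOn hx,
    iteratedFDerivWithin_congr h hx]

theorem UnifDerivCn.derivative (hf : UnifDerivCn (n + 1) U f) :
    UnifCn n U (fun i => fderiv ℝ (f i)) := by
  refine ⟨hf.isOpen, fun i => ?_, ?_⟩
  · have h : ContDiffOn ℝ ((n : WithTop ℕ∞) + 1) (f i) (U i) := by
      exact_mod_cast hf.contDiffOn i
    exact ((contDiffOn_succ_iff_fderiv_of_isOpen (hf.isOpen i)).1 h).2.2
  · obtain ⟨M, hM⟩ := hf.bound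
    refine ⟨M, fun i m hm x hx => ?_⟩
    rw [norm_iteratedFDerivWithin_fderiv_of_isOpen (hf.isOpen i) hx]
    exact hM i (m + 1) (by omega) (by omega) x hx

theorem UnifCn.derivative (hf : UnifCn (n + 1) U f) : UnifCn n U (fun i => fderiv ℝ (f i)) :=
  hf.unifDerivCn.derivative

/-- The engine of most inductions on the order below: a formula for the first derivative in terms of
functions already controlled in C^n gives control in C^(n+1). -/
theorem UnifDerivCn.of_fderiv (hd : ∀ i, DifferentiableOn ℝ (f i) (U i))
    (hf : UnifCn n U (fun i => fderiv ℝ (f i))) : UnifDerivCn (n + 1) U f := by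
  refine ⟨hf.isOpen, fun i => ?_, ?_⟩
  · exact_mod_cast (contDiffOn_succ_iff_fderiv_of_isOpen (n := n) (hf.isOpen i)).2
      ⟨hd i, by simp, hf.contDiffOn i⟩
  · obtain ⟨M, hM⟩ := hf.bound
    refine ⟨M, fun i m h1 hm x hx => ?_⟩
    obtain ⟨k, rfl⟩ : ∃ k, m = k + 1 := ⟨m - 1, by omega⟩
    rw [← norm_iteratedFDerivWithin_fderiv_of_isOpen (hf.isOpen i) hx]
    exact hM i k (by omega) x hx

theorem UnifDerivCn.unifCn (hf : UnifDerivCn n U f) {M : ℝ}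
    (hM : ∀ i, ∀ x ∈ U i, ‖f i x‖ ≤ M) : UnifCn n U f := by
  obtain ⟨M', hM'⟩ := hf.bound
  refine ⟨hf.isOpen, hf.contDiffOn, max M M', fun i m hm x hx => ?_⟩
  rcases Nat.eq_zero_or_pos m with rfl | h
  · exact le_max_of_le_left (by simpa using hM i x hx)
  · exact le_max_of_le_right (hM' i m h hm x hx)

theorem UnifCn.of_fderiv (hd : ∀ i, DifferentiableOn ℝ (f i) (U i)) {M : ℝ}
    (hM : ∀ i, ∀ x ∈ U i, ‖f i x‖ ≤ M)
    (hf : UnifCn n U (fun i => fderiv ℝ (f i))) : UnifCn (n + 1) U f :=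
  (UnifDerivCn.of_fderiv hd hf).unifCn hM

theorem UnifCn.const (hU : ∀ i, IsOpen (U i)) {c : ι → F} {M : ℝ} (hM : ∀ i, ‖c i‖ ≤ M) :
    UnifCn n U (fun i _ => c i) := by
  refine ⟨hU, fun i => contDiffOn_const, M, fun i m hm x hx => ?_⟩
  rcases Nat.eq_zero_or_pos m with rfl | h
  · simpa using hM i
  · rw [iteratedFDerivWithin_of_isOpen m (hU i) hx, iteratedFDeriv_const_of_ne h.ne']
    simpa using (norm_nonneg _).trans (hM i)

/-- Leibniz rule, with binomial coefficients summing to 2 ^ m. Scalar multiples, products and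
compositions of linear maps are all instances. -/
theorem UnifCn.bilinear (hf : UnifCn n U f) {g : ι → E → G} (hg : UnifCn n U g)
    (B : F →L[ℝ] G →L[ℝ] H) : UnifCn n U (fun i x => B (f i x) (g i x)) := by
  obtain ⟨M, hM⟩ := hf.bound
  obtain ⟨N, hN⟩ := hg.bound
  refine ⟨hf.isOpen, fun i => B.isBoundedBilinearMap.contDiff.comp_contDiffOn
      ((hf.contDiffOn i).prodMk (hg.contDiffOn i)), ‖B‖ * (2 ^ n * (|M| * |N|)),
      fun i m hm x hx => ?_⟩
  refine (B.norm_iteratedFDerivWithin_le_of_bilinear (hf.contDiffOn i) (hg.contDiffOn i)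
    (hf.isOpen i).uniqueDiffOn hx (by exact_mod_cast hm)).trans ?_
  gcongr
  calc _ ≤ ∑ k ∈ Finset.range (m + 1), (m.choose k : ℝ) * (|M| * |N|) := by
        refine Finset.sum_le_sum fun k hk => ?_
        rw [mul_assoc]
        have hk' := Finset.mem_range.1 hk
        gcongr
        · exact (hM i k (by omega) x hx).trans (le_abs_self M)
        · exact (hN i (m - k) (by omega) x hx).trans (le_abs_self N)
    _ = 2 ^ m * (|M| * |N|) := by
        rw [← Finset.sum_mul]
        exact_mod_cast congrArg (fun t : ℕ => (t : ℝ) * (|M| * |N|)) (Nat.sum_range_choose m)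
    _ ≤ 2 ^ n * (|M| * |N|) := by
        gcongr
        norm_num

theorem UnifCn.clm (hf : UnifCn n U f) (L : F →L[ℝ] G) : UnifCn n U (fun i x => L (f i x)) := by
  obtain ⟨M, hM⟩ := hf.bound
  refine ⟨hf.isOpen, fun i => L.contDiff.comp_contDiffOn (hf.contDiffOn i), ‖L‖ * M,
    fun i m hm x hx => ?_⟩
  refine (L.norm_iteratedFDerivWithin_comp_left (hf.contDiffOn i x hx)
    (hf.isOpen i).uniqueDiffOn hx (by exact_mod_cast hm)).trans ?_
  gcongr
  exact hM i m hm x hx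

theorem UnifDerivCn.add (hf : UnifDerivCn n U f) (hg : UnifDerivCn n U g) :
    UnifDerivCn n U (fun i x => f i x + g i x) := by
  obtain ⟨M, hM⟩ := hf.bound
  obtain ⟨N, hN⟩ := hg.bound
  refine ⟨hf.isOpen, fun i => (hf.contDiffOn i).add (hg.contDiffOn i), M + N,
    fun i m h1 hm x hx => ?_⟩
  have hm' : (m : WithTop ℕ∞) ≤ n := by exact_mod_cast hm
  rw [show (fun x => f i x + g i x) = f i + g i from rfl, iteratedFDerivWithin_add_apply
    (((hf.contDiffOn i) x hx).of_le hm') (((hg.contDiffOn i) x hx).of_le hm')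
    (hf.isOpen i).uniqueDiffOn hx]
  exact (norm_add_le _ _).trans (add_le_add (hM i m h1 hm x hx) (hN i m h1 hm x hx))

theorem UnifCn.add (hf : UnifCn n U f) (hg : UnifCn n U g) :
    UnifCn n U (fun i x => f i x + g i x) := by
  obtain ⟨M, -, hM⟩ := hf.norm_le
  obtain ⟨N, -, hN⟩ := hg.norm_le
  exact (hf.unifDerivCn.add hg.unifDerivCn).unifCn (M := M + N) fun i x hx =>
    (norm_add_le _ _).trans (add_le_add (hM i x hx) (hN i x hx))

theorem UnifCn.neg (hf : UnifCn n U f) : UnifCn n U (fun i x => -f i x) := by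
  simpa using hf.clm (-ContinuousLinearMap.id ℝ F)

theorem UnifCn.sub (hf : UnifCn n U f) (hg : UnifCn n U g) :
    UnifCn n U (fun i x => f i x - g i x) := by
  simpa [sub_eq_add_neg] using hf.add hg.neg

theorem UnifCn.smul {c : ι → E → ℝ} (hc : UnifCn n U c) (hf : UnifCn n U f) :
    UnifCn n U (fun i x => c i x • f i x) :=
  hc.bilinear hf (ContinuousLinearMap.lsmul ℝ ℝ)

theorem UnifCn.const_smul {c : ι → ℝ} {M : ℝ} (hc : ∀ i, |c i| ≤ M) (hf : UnifCn n U f) :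
    UnifCn n U (fun i x => c i • f i x) :=
  (UnifCn.const (c := c) hf.isOpen hc).smul hf

theorem UnifCn.mul {a b : ι → E → ℝ} (ha : UnifCn n U a) (hb : UnifCn n U b) :
    UnifCn n U (fun i x => a i x * b i x) :=
  ha.smul hb

theorem UnifCn.sum {κ : Type} (s : Finset κ) {f : κ → ι → E → F} (hU : ∀ i, IsOpen (U i))
    (hf : ∀ k ∈ s, UnifCn n U (f k)) : UnifCn n U (fun i x => ∑ k ∈ s, f k i x) := by
  classical
  induction s using Finset.induction_on with
  | empty => simpa using UnifCn.const (c := fun _ : ι => (0 : F)) (M := 0) hU (by simp)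
  | insert k s hk ih =>
    simp only [Finset.sum_insert hk]
    exact (hf k (by simp)).add (ih fun j hj => hf j (by simp [hj]))

theorem UnifCn.pow {a : ι → E → ℝ} (ha : UnifCn n U a) (k : ℕ) :
    UnifCn n U (fun i x => a i x ^ k) := by
  induction k with
  | zero => simpa using UnifCn.const (c := fun _ : ι => (1 : ℝ)) (M := 1) ha.isOpen (by simp)
  | succ k ih => simpa [pow_succ] using ih.mul ha

theorem UnifDerivCn.clm (hU : ∀ i, IsOpen (U i)) (L : E →L[ℝ] F) :
    UnifDerivCn n U (fun _ x => L x) := by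
  cases n with
  | zero => exact ⟨hU, fun i => L.contDiff.contDiffOn, 0, fun i m h1 h2 => by omega⟩
  | succ n =>
    refine UnifDerivCn.of_fderiv (fun i => L.differentiable.differentiableOn) ?_
    have h : fderiv ℝ (fun x => L x) = fun _ => L := funext fun x => L.fderiv
    rw [h]
    exact UnifCn.const (c := fun _ : ι => L) (M := ‖L‖) hU (by simp)

theorem UnifDerivCn.differentiableAt (hf : UnifDerivCn (n + 1) U f) {i : ι} {x : E}
    (hx : x ∈ U i) : DifferentiableAt ℝ (f i) x :=
  ((hf.contDiffOn i).differentiableOn (by simp)).differentiableAt ((hf.isOpen i).mem_nhds hx)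

theorem UnifDerivCn.of_le (hf : UnifDerivCn n U f) (h : m ≤ n) : UnifDerivCn m U f := by
  refine ⟨hf.isOpen, fun i => (hf.contDiffOn i).of_le (by exact_mod_cast h), ?_⟩
  obtain ⟨M, hM⟩ := hf.bound
  exact ⟨M, fun i k h1 hk => hM i k h1 (hk.trans h)⟩

/-- In the Faà di Bruno bound the inner map enters only through its derivatives of order at least
one. This is why `UnifDerivCn` suffices there, and it is needed: maps near the identity on the
universal cover are unbounded. -/
theorem UnifCn.comp {W : ι → Set F} {φ : ι → F → G} (hφ : UnifCn n W φ) (hf : UnifDerivCn n U f)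
    (h : ∀ i, Set.MapsTo (f i) (U i) (W i)) : UnifCn n U (fun i x => φ i (f i x)) := by
  obtain ⟨M, hM⟩ := hφ.bound
  obtain ⟨N, hN⟩ := hf.bound
  refine ⟨hf.isOpen, fun i => (hφ.contDiffOn i).comp (hf.contDiffOn i) (h i),
    n.factorial * |M| * (max N 1) ^ n, fun i m hm x hx => ?_⟩
  refine (norm_iteratedFDerivWithin_comp_le (hφ.contDiffOn i) (hf.contDiffOn i)
    (by exact_mod_cast hm) (hφ.isOpen i).uniqueDiffOn (hf.isOpen i).uniqueDiffOn (h i) hx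
    -- The k-th derivative of the inner map must be at most D ^ k; a common bound N gives this once
    -- D ≥ 1.
    (C := |M|) (D := max N 1)
    (fun k hk => (hM i k (hk.trans hm) _ (h i hx)).trans (le_abs_self M))
    (fun k h1 hk => ?_)).trans ?_
  · refine (hN i k h1 (hk.trans hm) x hx).trans ((le_max_left N 1).trans ?_)
    exact le_self_pow₀ (le_max_right _ _) (by omega)
  · have := Nat.factorial_le hm
    gcongr
    exact le_max_right _ _

theorem UnifDerivCn.comp {W : ι → Set F} {φ : ι → F → G} (hφ : UnifDerivCn n W φ)
    (hf : UnifDerivCn n U f) (h : ∀ i, Set.MapsTo (f i) (U i) (W i)) :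
    UnifDerivCn n U (fun i x => φ i (f i x)) := by
  cases n with
  | zero =>
    exact ⟨hf.isOpen, fun i => (hφ.contDiffOn i).comp (hf.contDiffOn i) (h i), 0,
      fun i m h1 h2 => by omega⟩
  | succ n =>
    have hd : ∀ i, ∀ x ∈ U i, HasFDerivAt (fun x => φ i (f i x))
        ((fderiv ℝ (φ i) (f i x)).comp (fderiv ℝ (f i) x)) x := fun i x hx =>
      (hφ.differentiableAt (h i hx)).hasFDerivAt.comp x (hf.differentiableAt hx).hasFDerivAt
    refine UnifDerivCn.of_fderiv (fun i x hx =>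
      (hd i x hx).differentiableAt.differentiableWithinAt) ?_
    exact ((hφ.derivative.comp (hf.of_le (Nat.le_succ n)) h).bilinear hf.derivative
      (ContinuousLinearMap.compL ℝ E F G)).congr fun i x hx => (hd i x hx).fderiv

end TwoStepNormalForm

/-! ### Inverses in uniformly bounded families. -/

namespace TwoStepNormalForm

variable {ι E F G H : Type}
  [NormedAddCommGroup E] [NormedSpace ℝ E] [NormedAddCommGroup F] [NormedSpace ℝ F]
  [NormedAddCommGroup G] [NormedSpace ℝ G] [NormedAddCommGroup H] [NormedSpace ℝ H]
  {n m : ℕ} {U : ι → Set E}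

/-- The derivative -A⁻¹ (dA) A⁻¹ involves the inverse at one order less, so a C⁰ bound on the
inverse starts an induction. -/
theorem UnifCn.ringInverse {R : Type} [NormedRing R] [HasSummableGeomSeries R] [NormedAlgebra ℝ R]
    {f : ι → E → R} (hf : UnifCn n U f) (hu : ∀ i, ∀ x ∈ U i, IsUnit (f i x)) {M : ℝ}
    (hM : ∀ i, ∀ x ∈ U i, ‖Ring.inverse (f i x)‖ ≤ M) :
    UnifCn n U (fun i x => Ring.inverse (f i x)) := by
  induction n with
  | zero =>
    refine UnifCn.of_continuousOn hf.isOpen (fun i x hx => ?_) hM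
    exact (differentiableAt_inverse (𝕜 := ℝ) (hu i x hx)).continuousAt.comp_continuousWithinAt
      (hf.continuousOn i x hx)
  | succ n ih =>
    have hd : ∀ i, ∀ x ∈ U i, HasFDerivAt (fun x => Ring.inverse (f i x))
        ((-ContinuousLinearMap.mulLeftRight ℝ R (Ring.inverse (f i x))
          (Ring.inverse (f i x))).comp (fderiv ℝ (f i) x)) x := fun i x hx => by
      obtain ⟨u, hu⟩ := hu i x hx
      have h := hasFDerivAt_ringInverse (𝕜 := ℝ) u
      rw [← Ring.inverse_unit, hu] at h
      exact h.comp x (hf.differentiableAt hx).hasFDerivAt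
    have h0 := ih (hf.of_le (Nat.le_succ n))
    refine UnifCn.of_fderiv (fun i x hx =>
      (hd i x hx).differentiableAt.differentiableWithinAt) hM ?_
    exact ((h0.bilinear h0 (ContinuousLinearMap.mulLeftRight ℝ R)).neg.bilinear hf.derivative
      (ContinuousLinearMap.compL ℝ E R R)).congr fun i x hx => (hd i x hx).fderiv

theorem UnifCn.inv {f : ι → E → ℝ} (hf : UnifCn n U f) {c : ℝ} (hc : 0 < c)
    (h : ∀ i, ∀ x ∈ U i, c ≤ f i x) : UnifCn n U (fun i x => (f i x)⁻¹) := by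
  have h1 := hf.ringInverse (M := c⁻¹)
    (fun i x hx => (hc.trans_le (h i x hx)).ne'.isUnit) (fun i x hx => ?_)
  · simpa using h1
  · rw [Ring.inverse_eq_inv', Real.norm_eq_abs, abs_inv, abs_of_pos (hc.trans_le (h i x hx))]
    exact inv_anti₀ hc (h i x hx)

/-! ### Integrals depending on a parameter. -/

section Integral

variable {g : ι → ℝ × E → F}

/-- The integration variable ranges over (-1, 2), a neighbourhood of [0, 1], so that integrands live
on open sets; projecting recovers that the parameter domain is open. -/
theorem UnifCn.isOpen_of_prod (hg : UnifCn n (fun i => Set.Ioo (-1 : ℝ) 2 ×ˢ U i) g) (i : ι) :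
    IsOpen (U i) := by
  have h := isOpenMap_snd _ (hg.isOpen i)
  rwa [Set.snd_image_prod ⟨0, by norm_num⟩] at h

theorem mem_Ioo_of_mem_Icc {t : ℝ} (ht : t ∈ Set.Icc (0 : ℝ) 1) : t ∈ Set.Ioo (-1 : ℝ) 2 :=
  ⟨by linarith [ht.1], by linarith [ht.2]⟩

theorem UnifCn.continuousOn_slice (hg : UnifCn n (fun i => Set.Ioo (-1 : ℝ) 2 ×ˢ U i) g) {i : ι}
    {x : E} (hx : x ∈ U i) : ContinuousOn (fun t => g i (t, x)) (Set.uIcc 0 1) := by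
  refine (hg.continuousOn i).comp (by fun_prop) fun t ht => ?_
  rw [Set.uIcc_of_le zero_le_one] at ht
  exact ⟨mem_Ioo_of_mem_Icc ht, hx⟩

theorem UnifCn.aestronglyMeasurable_slice
    (hg : UnifCn n (fun i => Set.Ioo (-1 : ℝ) 2 ×ˢ U i) g) {i : ι} {x : E} (hx : x ∈ U i) :
    MeasureTheory.AEStronglyMeasurable (fun t => g i (t, x))
      (MeasureTheory.volume.restrict (Set.uIoc 0 1)) :=
  ((hg.continuousOn_slice hx).mono Set.uIoc_subset_uIcc).aestronglyMeasurable measurableSet_uIoc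

theorem uIoc_subset_Ioo {t : ℝ} (ht : t ∈ Set.uIoc (0 : ℝ) 1) : t ∈ Set.Ioo (-1 : ℝ) 2 := by
  rw [Set.uIoc_of_le zero_le_one] at ht
  exact mem_Ioo_of_mem_Icc ⟨ht.1.le, ht.2⟩

theorem UnifCn.hasFDerivAt_integral (hg : UnifCn 1 (fun i => Set.Ioo (-1 : ℝ) 2 ×ˢ U i) g)
    {i : ι} {x : E} (hx : x ∈ U i) :
    HasFDerivAt (fun y => ∫ t in (0 : ℝ)..1, g i (t, y))
      (∫ t in (0 : ℝ)..1, (fderiv ℝ (g i) (t, x)).comp (ContinuousLinearMap.inr ℝ ℝ E)) x := by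
  have hg' : UnifCn 0 (fun i => Set.Ioo (-1 : ℝ) 2 ×ˢ U i)
      (fun i p => (fderiv ℝ (g i) p).comp (ContinuousLinearMap.inr ℝ ℝ E)) :=
    (UnifCn.derivative (n := 0) hg).clm
      ((ContinuousLinearMap.compL ℝ E (ℝ × E) F).flip (ContinuousLinearMap.inr ℝ ℝ E))
  obtain ⟨M, -, hM⟩ := hg'.norm_le
  refine intervalIntegral.hasFDerivAt_integral_of_dominated_of_fderiv_le (bound := fun _ => M)
    (F' := fun y t => (fderiv ℝ (g i) (t, y)).comp (ContinuousLinearMap.inr ℝ ℝ E))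
    ((hg.isOpen_of_prod i).mem_nhds hx) ?_ (hg.continuousOn_slice hx).intervalIntegrable
    (hg'.aestronglyMeasurable_slice hx) ?_ (by simp) ?_
  · filter_upwards [(hg.isOpen_of_prod i).mem_nhds hx] with y hy
    exact hg.aestronglyMeasurable_slice hy
  · exact Filter.Eventually.of_forall fun t ht y hy => hM i (t, y) ⟨uIoc_subset_Ioo ht, hy⟩
  · refine Filter.Eventually.of_forall fun t ht y hy => ?_
    have h1 := (UnifCn.differentiableAt (n := 0) hg (i := i) (x := (t, y))
      ⟨uIoc_subset_Ioo ht, hy⟩).hasFDerivAt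
    exact h1.comp y (hasFDerivAt_prodMk_right t y)

theorem UnifCn.integral (hg : UnifCn n (fun i => Set.Ioo (-1 : ℝ) 2 ×ˢ U i) g) :
    UnifCn n U (fun i x => ∫ t in (0 : ℝ)..1, g i (t, x)) := by
  obtain ⟨M, -, hM⟩ := hg.norm_le
  have hb : ∀ i, ∀ x ∈ U i, ‖∫ t in (0 : ℝ)..1, g i (t, x)‖ ≤ M := fun i x hx => by
    simpa using intervalIntegral.norm_integral_le_of_norm_le_const (a := (0 : ℝ)) (b := 1)
      (f := fun t => g i (t, x)) fun t ht => hM i (t, x) ⟨uIoc_subset_Ioo ht, hx⟩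
  -- The target space must vary: the derivative of the integral is again such an integral, with
  -- values in `E →L[ℝ] F`.
  induction n generalizing F M with
  | zero =>
    refine UnifCn.of_continuousOn hg.isOpen_of_prod (fun i x hx => ?_) hb
    refine ContinuousAt.continuousWithinAt ?_
    refine intervalIntegral.continuousAt_of_dominated_interval (bound := fun _ => M) ?_ ?_
      (by simp) ?_
    · filter_upwards [(hg.isOpen_of_prod i).mem_nhds hx] with y hy
      exact hg.aestronglyMeasurable_slice hy
    · filter_upwards [(hg.isOpen_of_prod i).mem_nhds hx] with y hy
      exact Filter.Eventually.of_forall fun t ht => hM i (t, y) ⟨uIoc_subset_Ioo ht, hy⟩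
    · refine Filter.Eventually.of_forall fun t ht => ?_
      have h1 := (hg.continuousOn i).continuousAt
        ((hg.isOpen i).mem_nhds (x := (t, x)) ⟨uIoc_subset_Ioo ht, hx⟩)
      exact h1.comp (f := fun y => (t, y)) (by fun_prop)
  | succ n ih =>
    have hd := fun i x (hx : x ∈ U i) => (hg.of_le (by omega : 1 ≤ n + 1)).hasFDerivAt_integral hx
    have hg' : UnifCn n (fun i => Set.Ioo (-1 : ℝ) 2 ×ˢ U i)
        (fun i p => (fderiv ℝ (g i) p).comp (ContinuousLinearMap.inr ℝ ℝ E)) :=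
      hg.derivative.clm
        ((ContinuousLinearMap.compL ℝ E (ℝ × E) F).flip (ContinuousLinearMap.inr ℝ ℝ E))
    obtain ⟨M', -, hM'⟩ := hg'.norm_le
    refine UnifCn.of_fderiv (fun i x hx =>
      (hd i x hx).differentiableAt.differentiableWithinAt) hb ?_
    refine (ih hg' M' hM' fun i x hx => ?_).congr fun i x hx => (hd i x hx).fderiv
    simpa using intervalIntegral.norm_integral_le_of_norm_le_const (a := (0 : ℝ)) (b := 1)
      (f := fun t => (fderiv ℝ (g i) (t, x)).comp (ContinuousLinearMap.inr ℝ ℝ E))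
      fun t ht => hM' i (t, x) ⟨uIoc_subset_Ioo ht, hx⟩

end Integral

theorem isOpen_Ioo_prod {X : Type} [TopologicalSpace X] {U : ι → Set X}
    (hU : ∀ i, IsOpen (U i)) (i : ι) :
    IsOpen (Set.Ioo (-1 : ℝ) 2 ×ˢ U i) :=
  isOpen_Ioo.prod (hU i)

theorem UnifDerivCn.comp_snd {f : ι → E → F} (hf : UnifDerivCn n U f) :
    UnifDerivCn n (fun i => Set.Ioo (-1 : ℝ) 2 ×ˢ U i) (fun i p => f i p.2) :=
  hf.comp (UnifDerivCn.clm (isOpen_Ioo_prod hf.isOpen) (ContinuousLinearMap.snd ℝ ℝ E))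
    fun _ _ hp => hp.2

theorem UnifCn.comp_snd {f : ι → E → F} (hf : UnifCn n U f) :
    UnifCn n (fun i => Set.Ioo (-1 : ℝ) 2 ×ˢ U i) (fun i p => f i p.2) :=
  hf.comp (UnifDerivCn.clm (isOpen_Ioo_prod hf.isOpen) (ContinuousLinearMap.snd ℝ ℝ E))
    fun _ _ hp => hp.2

theorem UnifCn.fst (hU : ∀ i, IsOpen (U i)) :
    UnifCn n (fun i => Set.Ioo (-1 : ℝ) 2 ×ˢ U i) (fun _ p => p.1) :=
  (UnifDerivCn.clm (isOpen_Ioo_prod hU) (ContinuousLinearMap.fst ℝ ℝ E)).unifCn (M := 2)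
    fun i p hp => abs_le.2 ⟨(by linarith [hp.1.1] : -2 ≤ p.1), hp.1.2.le⟩

/-! ### Hadamard quotients of first and second order. -/

section Hadamard

variable {V : ι → Set F} {φ : ι → F → G} {γ w : ι → E → F} {δ : ι → ℝ} {D : ℝ}

/-- The integrand of the Hadamard quotient of `φ` between `γ` and `γ + δ w`. -/
theorem UnifCn.hadamard_integrand (hφ : UnifCn (n + 1) V φ) (hγ : UnifDerivCn n U γ)
    (hw : UnifCn n U w) (hδ : ∀ i, |δ i| ≤ D)
    (hV : ∀ i, ∀ x ∈ U i, ∀ t : ℝ, |t| ≤ 2 → γ i x + (t * δ i) • w i x ∈ V i) :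
    UnifCn n (fun i => Set.Ioo (-1 : ℝ) 2 ×ˢ U i)
      (fun i p => fderiv ℝ (φ i) (γ i p.2 + (p.1 * δ i) • w i p.2) (w i p.2)) := by
  have h1 : UnifCn n (fun i => Set.Ioo (-1 : ℝ) 2 ×ˢ U i) (fun i p => p.1 * δ i) := by
    simpa [mul_comm] using (UnifCn.fst (n := n) hγ.isOpen).const_smul hδ
  have h2 := hγ.comp_snd.add (h1.smul hw.comp_snd).unifDerivCn
  refine (hφ.derivative.comp h2 fun i p hp => ?_).bilinear hw.comp_snd (ContinuousLinearMap.id ℝ _)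
  exact hV i p.2 hp.2 p.1 (abs_le.2 ⟨by linarith [hp.1.1], hp.1.2.le⟩)

theorem UnifCn.hadamard_eq [CompleteSpace G] (hφ : UnifCn (n + 1) V φ) (hγ : UnifDerivCn n U γ)
    (hw : UnifCn n U w) (hδ : ∀ i, |δ i| ≤ D)
    (hV : ∀ i, ∀ x ∈ U i, ∀ t : ℝ, |t| ≤ 2 → γ i x + (t * δ i) • w i x ∈ V i)
    {i : ι} {x : E} (hx : x ∈ U i) :
    φ i (γ i x + δ i • w i x) - φ i (γ i x) = δ i • ∫ t in (0 : ℝ)..1,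
      fderiv ℝ (φ i) (γ i x + (t * δ i) • w i x) (w i x) := by
  have hc := (hφ.hadamard_integrand hγ hw hδ hV).continuousOn_slice hx
  have h := intervalIntegral.integral_eq_sub_of_hasDerivAt (a := 0) (b := 1)
    (f := fun t : ℝ => φ i (γ i x + (t * δ i) • w i x))
    (f' := fun t : ℝ => δ i • fderiv ℝ (φ i) (γ i x + (t * δ i) • w i x) (w i x))
    (fun t ht => ?_) (hc.const_smul (δ i)).intervalIntegrable
  · rw [← intervalIntegral.integral_smul, h]
    simp
  · rw [Set.uIcc_of_le zero_le_one] at ht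
    have h1 : HasDerivAt (fun t : ℝ => γ i x + (t * δ i) • w i x) (δ i • w i x) t := by
      have := ((hasDerivAt_mul_const (δ i) (x := t)).smul_const (w i x)).const_add (γ i x)
      simpa using this
    have h2 := (hφ.differentiableAt (hV i x hx t
      (abs_le.2 ⟨by linarith [ht.1], by linarith [ht.2]⟩))).hasFDerivAt.comp_hasDerivAt t h1
    rw [map_smul] at h2
    exact h2

/-- Writing the increment as an integral of the derivative keeps the quotient bounded in C^n
uniformly as δ → 0, at the cost of one derivative of φ. -/
theorem UnifCn.exists_quotient [CompleteSpace G] (hφ : UnifCn (n + 1) V φ)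
    (hγ : UnifDerivCn n U γ) (hw : UnifCn n U w) (hδ : ∀ i, |δ i| ≤ D)
    (hV : ∀ i, ∀ x ∈ U i, ∀ t : ℝ, |t| ≤ 2 → γ i x + (t * δ i) • w i x ∈ V i) :
    ∃ Q : ι → E → G, UnifCn n U Q ∧
      ∀ i, ∀ x ∈ U i, φ i (γ i x + δ i • w i x) - φ i (γ i x) = δ i • Q i x :=
  ⟨_, (hφ.hadamard_integrand hγ hw hδ hV).integral, fun _ _ hx =>
    hφ.hadamard_eq hγ hw hδ hV hx⟩

/-- The first-order quotient is applied to the derivative of φ, with displacement t w and with t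
adjoined to the variables, then integrated in t. Two parameters of size at most 2 get multiplied,
hence the 4 in `hV`. -/
theorem UnifCn.exists_quotient_sq [CompleteSpace G] (hφ : UnifCn (n + 2) V φ)
    (hγ : UnifDerivCn n U γ) (hw : UnifCn n U w) (hδ : ∀ i, |δ i| ≤ D)
    (hV : ∀ i, ∀ x ∈ U i, ∀ t : ℝ, |t| ≤ 4 → γ i x + (t * δ i) • w i x ∈ V i) :
    ∃ Q : ι → E → G, UnifCn n U Q ∧ ∀ i, ∀ x ∈ U i,
      φ i (γ i x + δ i • w i x) - φ i (γ i x) - δ i • fderiv ℝ (φ i) (γ i x) (w i x)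
        = δ i ^ 2 • Q i x := by
  have hV' : ∀ i, ∀ x ∈ U i, ∀ t : ℝ, |t| ≤ 2 → γ i x + (t * δ i) • w i x ∈ V i :=
    fun i x hx t ht => hV i x hx t (by linarith)
  obtain ⟨Q, hQ, hQe⟩ := UnifCn.exists_quotient (n := n) (hφ.derivative) hγ.comp_snd
    ((UnifCn.fst hγ.isOpen).smul hw.comp_snd) hδ (fun i p hp t ht => by
      rw [smul_smul, show t * δ i * p.1 = t * p.1 * δ i by ring]
      refine hV i p.2 hp.2 _ ?_
      rw [abs_mul]
      have : |p.1| ≤ 2 := abs_le.2 ⟨by linarith [hp.1.1], hp.1.2.le⟩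
      nlinarith [abs_nonneg t, abs_nonneg p.1])
  have hQw := hQ.bilinear hw.comp_snd (ContinuousLinearMap.id ℝ _)
  refine ⟨_, hQw.integral, fun i x hx => ?_⟩
  have hφ1 := hφ.of_le (by omega : n + 1 ≤ n + 2)
  have hc := (hφ1.hadamard_integrand hγ hw hδ hV').continuousOn_slice hx
  have hconst : δ i • fderiv ℝ (φ i) (γ i x) (w i x)
      = δ i • ∫ _ in (0 : ℝ)..1, fderiv ℝ (φ i) (γ i x) (w i x) := by simp
  rw [hφ1.hadamard_eq hγ hw hδ hV' hx, hconst, ← smul_sub, ← intervalIntegral.integral_sub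
    hc.intervalIntegrable (by simp), pow_two, mul_smul]
  congr 1
  rw [← intervalIntegral.integral_smul]
  refine intervalIntegral.integral_congr fun t ht => ?_
  rw [Set.uIcc_of_le zero_le_one] at ht
  have h := hQe i (t, x) ⟨mem_Ioo_of_mem_Icc ht, hx⟩
  have h' := congrArg (fun A : F →L[ℝ] G => A (w i x)) h
  simpa [smul_smul, mul_comm] using h'

end Hadamard

end TwoStepNormalForm

/-! ### Inverting maps close to the identity. -/

namespace TwoStepNormalForm

variable {ι E F : Type}
  [NormedAddCommGroup E] [NormedSpace ℝ E] [NormedAddCommGroup F] [NormedSpace ℝ F]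

section InverseMap

/-- By the mean value inequality Ψ - id is 1/2-Lipschitz on a convex set. This serves both
injectivity and continuity of inverses. -/
theorem dist_le_two_mul_of_fderiv_near_id {W : Set E} {Ψ : E → E} (hW : Convex ℝ W)
    (hΨ : ∀ x ∈ W, DifferentiableAt ℝ Ψ x)
    (hd : ∀ x ∈ W, ‖fderiv ℝ Ψ x - ContinuousLinearMap.id ℝ E‖ ≤ 1 / 2) {x y : E}
    (hx : x ∈ W) (hy : y ∈ W) : ‖x - y‖ ≤ 2 * ‖Ψ x - Ψ y‖ := by
  have h := hW.norm_image_sub_le_of_norm_hasFDerivWithin_le (f := fun z => Ψ z - z)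
    (f' := fun z => fderiv ℝ Ψ z - ContinuousLinearMap.id ℝ E)
    (fun z hz => ((hΨ z hz).hasFDerivAt.sub (hasFDerivAt_id z)).hasFDerivWithinAt) hd hy hx
  have h1 : x - y = (Ψ x - Ψ y) - ((Ψ x - x) - (Ψ y - y)) := by abel
  have h2 := norm_sub_le (Ψ x - Ψ y) ((Ψ x - x) - (Ψ y - y))
  rw [← h1] at h2
  linarith

theorem isUnit_of_norm_sub_id_le [CompleteSpace E] {A : E →L[ℝ] E}
    (hA : ‖A - ContinuousLinearMap.id ℝ E‖ ≤ 1 / 2) : IsUnit A ∧ ‖Ring.inverse A‖ ≤ 2 := by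
  have h1 : ‖1 - A‖ < 1 := by
    rw [norm_sub_rev]
    exact hA.trans_lt (by norm_num)
  have h2 : IsUnit A := by
    have h := (Units.oneSub (1 - A) h1).isUnit
    rwa [Units.val_oneSub, sub_sub_cancel] at h
  refine ⟨h2, ?_⟩
  have h3 : Ring.inverse A = 1 + (1 - A) * Ring.inverse A := by
    rw [sub_mul, Ring.mul_inverse_cancel A h2]
    simp
  have h4 : ‖Ring.inverse A‖ ≤ 1 + 1 / 2 * ‖Ring.inverse A‖ := by
    calc _ = ‖1 + (1 - A) * Ring.inverse A‖ := by rw [← h3]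
      _ ≤ ‖(1 : E →L[ℝ] E)‖ + ‖1 - A‖ * ‖Ring.inverse A‖ :=
        (norm_add_le _ _).trans (add_le_add le_rfl (norm_mul_le _ _))
      _ ≤ _ := by
        gcongr
        · exact ContinuousLinearMap.norm_id_le
        · rw [norm_sub_rev]
          exact hA
  linarith

variable {n : ℕ} {W : ι → Set E} {Ψ Θ : ι → E → E}

/-- Bootstrap: Θ is 2-Lipschitz, hence differentiable with DΘ = (DΨ ∘ Θ)⁻¹, and this formula turns
C^k control of Θ into C^(k+1) control. -/
theorem UnifDerivCn.rightInverse [CompleteSpace E] (hΨ : UnifDerivCn (n + 1) W Ψ)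
    (hW : ∀ i, Convex ℝ (W i))
    (hd : ∀ i, ∀ x ∈ W i, ‖fderiv ℝ (Ψ i) x - ContinuousLinearMap.id ℝ E‖ ≤ 1 / 2)
    (hΘ : ∀ i, Set.MapsTo (Θ i) (W i) (W i)) (hinv : ∀ i, ∀ x ∈ W i, Ψ i (Θ i x) = x) :
    UnifDerivCn (n + 1) W Θ := by
  have hc : ∀ i, ∀ x ∈ W i, ContinuousAt (Θ i) x := fun i x hx => by
    refine ContinuousOn.continuousAt (s := W i) ?_ ((hΨ.isOpen i).mem_nhds hx)
    refine LipschitzOnWith.continuousOn (K := 2) (LipschitzOnWith.of_dist_le_mul ?_)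
    intro a ha b hb
    have h := dist_le_two_mul_of_fderiv_near_id (hW i)
      (fun z hz => hΨ.differentiableAt hz) (hd i) (hΘ i ha) (hΘ i hb)
    rw [hinv i a ha, hinv i b hb] at h
    simpa [dist_eq_norm] using h
  have hf : ∀ i, ∀ x ∈ W i,
      HasFDerivAt (Θ i) (Ring.inverse (fderiv ℝ (Ψ i) (Θ i x))) x := fun i x hx => by
    obtain ⟨u, hu⟩ := (isUnit_of_norm_sub_id_le (hd i _ (hΘ i hx))).1
    rw [← hu, Ring.inverse_unit]
    refine HasFDerivAt.of_local_left_inverse (f := Ψ i) (f' := ContinuousLinearEquiv.ofUnit u)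
      (hc i x hx) ?_ ?_
    · have h := (hΨ.differentiableAt (hΘ i hx)).hasFDerivAt
      rw [← hu] at h
      exact h
    · filter_upwards [(hΨ.isOpen i).mem_nhds hx] with y hy using hinv i y hy
  suffices h : ∀ k ≤ n + 1, UnifDerivCn k W Θ from h _ le_rfl
  intro k
  induction k with
  | zero =>
    intro _
    exact ⟨hΨ.isOpen, fun i => by
      simpa using ContinuousOn.congr
        (fun x hx => (hc i x hx).continuousWithinAt) fun _ _ => rfl, 0, fun i m h1 h2 => by omega⟩
  | succ k ih =>
    intro hk
    refine UnifDerivCn.of_fderiv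
      (fun i x hx => (hf i x hx).differentiableAt.differentiableWithinAt) ?_
    refine UnifCn.congr ?_ fun i x hx => (hf i x hx).fderiv
    exact ((hΨ.derivative.of_le (by omega : k ≤ n)).comp (ih (by omega)) hΘ).ringInverse
      (fun i x hx => (isUnit_of_norm_sub_id_le (hd i _ (hΘ i hx))).1)
      (fun i x hx => (isUnit_of_norm_sub_id_le (hd i _ (hΘ i hx))).2)

/-- A perturbation of the identity by a strict contraction is onto. -/
theorem exists_add_eq {E : Type} [NormedAddCommGroup E] [CompleteSpace E] {u : E → E}
    (hu : ∀ x y, ‖u x - u y‖ ≤ 1 / 2 * ‖x - y‖)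
    (z : E) : ∃ x, x + u x = z := by
  have hT : ContractingWith (1 / 2) fun x => z - u x := by
    refine ⟨by norm_num, LipschitzWith.of_dist_le_mul fun x y => ?_⟩
    rw [dist_eq_norm, dist_eq_norm, sub_sub_sub_cancel_left, norm_sub_rev]
    simpa using hu x y
  refine ⟨ContractingWith.fixedPoint _ hT, ?_⟩
  have h := hT.fixedPoint_isFixedPt
  have h' : z - u (ContractingWith.fixedPoint _ hT) = ContractingWith.fixedPoint _ hT := h
  rw [← sub_eq_iff_eq_add.1 h']

end InverseMap

/-! ### Averages and primitives in the fast angle. -/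

section AngleIntegral

/-- The direction of the fast angle. -/
abbrev fastDir : PhaseSpace := phaseBasis (Sum.inl 1)

/-- The integral of `f` against the affine weight `a + b t` along the fast angle. -/
noncomputable def angleIntegral (a b : ℝ) (f : PhaseSpace → ℝ) (x : PhaseSpace) : ℝ :=
  ∫ t in (0 : ℝ)..1, (a + b * t) * f (x + t • fastDir)

/-- The primitive of zero mean, in the fast angle, of the oscillating part of `f`. -/
noncomputable abbrev anglePrimitive (f : PhaseSpace → ℝ) : PhaseSpace → ℝ :=
  angleIntegral (-1 / 2) 1 f

variable {n : ℕ} {U : ι → Set ActionSpace} {f : ι → PhaseSpace → ℝ}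

theorem add_smul_fastDir_mem {S : Set ActionSpace} {x : PhaseSpace} (hx : x ∈ torusTimes S)
    (t : ℝ) : x + t • fastDir ∈ torusTimes S := by
  refine ⟨trivial, ?_⟩
  simpa [fastDir, phaseBasis] using hx.2

theorem UnifCn.angleIntegral_integrand (hf : UnifCn n (fun i => torusTimes (U i)) f) (a b : ℝ) :
    UnifCn n (fun i => Set.Ioo (-1 : ℝ) 2 ×ˢ torusTimes (U i))
      (fun i p => (a + b * p.1) * f i (p.2 + p.1 • fastDir)) := by
  have h1 := UnifCn.const (n := n) (c := fun _ : ι => a) (M := |a|) (isOpen_Ioo_prod hf.isOpen)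
    (by simp)
  have h2 := (UnifCn.fst (n := n) hf.isOpen).const_smul (c := fun _ : ι => b) (M := |b|) (by simp)
  have h3 := hf.comp (UnifDerivCn.clm (isOpen_Ioo_prod hf.isOpen)
    (ContinuousLinearMap.snd ℝ ℝ PhaseSpace
      + (ContinuousLinearMap.fst ℝ ℝ PhaseSpace).smulRight fastDir))
    (fun i p hp => add_smul_fastDir_mem hp.2 p.1)
  exact (h1.add h2).mul h3

theorem unifCn_angleIntegral (hf : UnifCn n (fun i => torusTimes (U i)) f) (a b : ℝ) :
    UnifCn n (fun i => torusTimes (U i)) (fun i => angleIntegral a b (f i)) :=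
  (hf.angleIntegral_integrand a b).integral

theorem UnifCn.fderiv_angleIntegral (hf : UnifCn 1 (fun i => torusTimes (U i)) f) (a b : ℝ)
    {i : ι} {x : PhaseSpace} (hx : x ∈ torusTimes (U i)) (v : PhaseSpace) :
    fderiv ℝ (angleIntegral a b (f i)) x v
      = angleIntegral a b (fun y => fderiv ℝ (f i) y v) x := by
  have hg := hf.angleIntegral_integrand a b
  have hd : fderiv ℝ (angleIntegral a b (f i)) x = _ := (hg.hasFDerivAt_integral hx).fderiv
  rw [hd, ContinuousLinearMap.intervalIntegral_apply]
  · refine intervalIntegral.integral_congr fun t ht => ?_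
    rw [Set.uIcc_of_le zero_le_one] at ht
    have h1 : HasFDerivAt (fun y => (a + b * t) * f i (y + t • fastDir))
        ((a + b * t) • fderiv ℝ (f i) (x + t • fastDir)) x := by
      have h2 := (hf.differentiableAt (n := 0) (add_smul_fastDir_mem hx t)).hasFDerivAt
      exact (h2.comp x ((hasFDerivAt_id x).add_const _)).const_mul _
    have h3 := (hg.differentiableAt (n := 0) (i := i) (x := (t, x))
      ⟨mem_Ioo_of_mem_Icc ht, hx⟩).hasFDerivAt.comp x (hasFDerivAt_prodMk_right t x)
    have h4 := h3.unique h1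
    exact congrArg (fun A : PhaseSpace →L[ℝ] ℝ => A v) h4
  · have h := (hg.derivative (n := 0)).clm
      ((ContinuousLinearMap.compL ℝ PhaseSpace (ℝ × PhaseSpace) ℝ).flip
        (ContinuousLinearMap.inr ℝ ℝ PhaseSpace))
    exact (h.continuousOn_slice hx).intervalIntegrable

theorem isPeriodic_angleIntegral {S : Set ActionSpace} {f : PhaseSpace → ℝ} (hf : IsPeriodic S f)
    (a b : ℝ) : IsPeriodic S (angleIntegral a b f) := by
  intro x hx k
  refine intervalIntegral.integral_congr fun t _ => ?_
  have h := hf _ (add_smul_fastDir_mem hx t) k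
  simp only [add_right_comm x (latticeVec k)]
  rw [h]

theorem IsPeriodic.add_fastDir {S : Set ActionSpace} {f : PhaseSpace → ℝ} (hf : IsPeriodic S f)
    {x : PhaseSpace} (hx : x ∈ torusTimes S) : f (x + fastDir) = f x := by
  rw [← hf x hx (Pi.single 1 1)]
  congr 2
  ext i <;> fin_cases i <;> simp [latticeVec, fastDir, phaseBasis]

theorem average_add_smul_fastDir (f : PhaseSpace → ℝ) (x : PhaseSpace) (t : ℝ) :
    average f (x + t • fastDir) = average f x := by
  simp [average, fastDir, phaseBasis]

/-- By periodicity the period may start at θ₂ instead of 0. The average thus becomes an integral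
over translates of x, of the same type as the primitive. -/
theorem IsPeriodic.average_eq {S : Set ActionSpace} {f : PhaseSpace → ℝ} (hf : IsPeriodic S f)
    {x : PhaseSpace} (hx : x ∈ torusTimes S) : average f x = angleIntegral 1 0 f x := by
  have h1 : ∀ t : ℝ, x + t • fastDir = (![x.1 0, x.1 1 + t], x.2) := fun t => by
    ext i <;> fin_cases i <;> simp [fastDir, phaseBasis]
  have h2 : Function.Periodic (fun s => f (![x.1 0, s], x.2)) 1 := fun s => by
    show f (![x.1 0, s + 1], x.2) = f (![x.1 0, s], x.2)
    have h3 : ((![x.1 0, s], x.2) : PhaseSpace) ∈ torusTimes S := ⟨trivial, hx.2⟩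
    have h4 := hf.add_fastDir h3
    rw [← h4]
    refine congrArg f ?_
    ext i <;> fin_cases i <;> simp [fastDir, phaseBasis, Matrix.vecHead, Matrix.vecTail]
  have h5 := h2.intervalIntegral_add_eq (x.1 1) 0
  rw [angleIntegral]
  simp only [h1, zero_mul, add_zero, one_mul]
  rw [intervalIntegral.integral_comp_add_left (fun s => f (![x.1 0, s], x.2)), add_zero, h5,
    zero_add]
  rfl

theorem unifCn_average (hf : UnifCn n (fun i => torusTimes (U i)) f)
    (hp : ∀ i, IsPeriodic (U i) (f i)) :
    UnifCn n (fun i => torusTimes (U i)) (fun i => average (f i)) :=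
  (unifCn_angleIntegral hf 1 0).congr fun i _ hx => (hp i).average_eq hx

theorem isPeriodic_average {S : Set ActionSpace} {f : PhaseSpace → ℝ} (hf : IsPeriodic S f) :
    IsPeriodic S (average f) := by
  intro x hx k
  have hx' : x + latticeVec k ∈ torusTimes S := ⟨trivial, by simpa [latticeVec] using hx.2⟩
  rw [hf.average_eq hx', hf.average_eq hx, isPeriodic_angleIntegral hf 1 0 x hx k]

/-- Integration by parts: the weight t - 1/2 increases by 1 over a period, so the boundary term is
f, and its derivative 1 gives minus the average. -/
theorem UnifCn.fderiv_anglePrimitive_fastDir (hf : UnifCn 1 (fun i => torusTimes (U i)) f)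
    (hp : ∀ i, IsPeriodic (U i) (f i)) {i : ι} {x : PhaseSpace} (hx : x ∈ torusTimes (U i)) :
    fderiv ℝ (anglePrimitive (f i)) x fastDir = f i x - average (f i) x := by
  rw [hf.fderiv_angleIntegral _ _ hx, (hp i).average_eq hx]
  have hline : ∀ t : ℝ, HasDerivAt (fun t : ℝ => f i (x + t • fastDir))
      (fderiv ℝ (f i) (x + t • fastDir) fastDir) t := fun t => by
    have h1 : HasDerivAt (fun t : ℝ => x + t • fastDir) fastDir t := by
      simpa using ((hasDerivAt_id t).smul_const fastDir).const_add x
    exact (hf.differentiableAt (n := 0) (add_smul_fastDir_mem hx t)).hasFDerivAt.comp_hasDerivAt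
      t h1
  have hcont : Continuous fun t : ℝ => fderiv ℝ (f i) (x + t • fastDir) fastDir := by
    have h1 := (hf.derivative (n := 0)).continuousOn i
    have h2 := h1.comp_continuous (f := fun t : ℝ => x + t • fastDir) (by fun_prop)
      fun t => add_smul_fastDir_mem hx t
    fun_prop
  have h := intervalIntegral.integral_mul_deriv_eq_deriv_mul (a := 0) (b := 1)
    (u := fun t : ℝ => -1 / 2 + 1 * t) (u' := fun _ => 1) (v := fun t : ℝ => f i (x + t • fastDir))
    (v' := fun t : ℝ => fderiv ℝ (f i) (x + t • fastDir) fastDir)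
    (fun t _ => by simpa using (hasDerivAt_id t).const_add (-1 / 2 : ℝ)) (fun t _ => hline t)
    (by simp) (hcont.intervalIntegrable _ _)
  have hper := (hp i).add_fastDir hx
  simp only [angleIntegral]
  rw [h]
  simp only [one_smul, zero_smul, add_zero, hper, mul_one, mul_zero, zero_mul]
  ring

/-- After exchanging the integrals the average of f factors out, and the weight t - 1/2 has integral
zero. -/
theorem UnifCn.average_anglePrimitive (hf : UnifCn 0 (fun i => torusTimes (U i)) f)
    (hp : ∀ i, IsPeriodic (U i) (f i)) {i : ι} {x : PhaseSpace} (hx : x ∈ torusTimes (U i)) :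
    average (anglePrimitive (f i)) x = 0 := by
  rw [(isPeriodic_angleIntegral (hp i) _ _).average_eq hx]
  have hc : Continuous fun p : ℝ × ℝ =>
      (1 + 0 * p.1) * ((-1 / 2 + 1 * p.2) * f i (x + p.1 • fastDir + p.2 • fastDir)) := by
    have h := (hf.continuousOn i).comp_continuous
      (f := fun p : ℝ × ℝ => x + p.1 • fastDir + p.2 • fastDir) (by fun_prop)
      fun p => add_smul_fastDir_mem (add_smul_fastDir_mem hx p.1) p.2
    exact (by fun_prop : Continuous fun p : ℝ × ℝ => 1 + 0 * p.1).mul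
      ((by fun_prop : Continuous fun p : ℝ × ℝ => -1 / 2 + 1 * p.2).mul h)
  have h0 : angleIntegral 1 0 (anglePrimitive (f i)) x
      = ∫ s in (0 : ℝ)..1, ∫ t in (0 : ℝ)..1,
        (1 + 0 * s) * ((-1 / 2 + 1 * t) * f i (x + s • fastDir + t • fastDir)) := by
    simp only [angleIntegral, intervalIntegral.integral_const_mul]
  rw [h0, MeasureTheory.intervalIntegral_intervalIntegral_swap]
  · have h1 : ∀ t : ℝ, ∫ s in (0 : ℝ)..1,
        (1 + 0 * s) * ((-1 / 2 + 1 * t) * f i (x + s • fastDir + t • fastDir))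
          = (-1 / 2 + 1 * t) * average (f i) x := fun t => by
      rw [← average_add_smul_fastDir (f i) x t,
        (hp i).average_eq (add_smul_fastDir_mem hx t), angleIntegral,
        ← intervalIntegral.integral_const_mul]
      refine intervalIntegral.integral_congr fun s _ => ?_
      simp only [add_right_comm x (s • fastDir)]
      ring
    simp only [h1]
    rw [intervalIntegral.integral_mul_const, intervalIntegral.integral_add (by simp)
      ((by fun_prop : Continuous fun t : ℝ => 1 * t).intervalIntegrable _ _)]
    norm_num
  · refine (hc.continuousOn.integrableOn_compact (K := Set.Icc 0 1 ×ˢ Set.Icc 0 1)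
      (isCompact_Icc.prod isCompact_Icc)).mono_set ?_
    rw [Set.uIoc_of_le zero_le_one]
    exact Set.prod_mono Set.Ioc_subset_Icc_self Set.Ioc_subset_Icc_self

end AngleIntegral

end TwoStepNormalForm

/-! ### The approximate homological equation. -/

namespace TwoStepNormalForm

variable {ι E F : Type}
  [NormedAddCommGroup E] [NormedSpace ℝ E] [NormedAddCommGroup F] [NormedSpace ℝ F]

/-- If `a = O(ε)` in `C⁰` and `a = O(1)` in `C^n`, then `a ^ (p + 1) = O(ε)` in `C^p`. -/
theorem UnifCn.pow_succ_div {n : ℕ} {U : ι → Set E} {a : ι → E → ℝ} (ha : UnifCn n U a)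
    {ε : ι → ℝ} (hε : ∀ i, 0 < ε i) {c : ℝ} (hc : ∀ i, ∀ x ∈ U i, |a i x| ≤ c * ε i) (p : ℕ) :
    ∀ k ≤ n, k ≤ p → UnifCn k U (fun i x => a i x ^ (p + 1) * (ε i)⁻¹) := by
  obtain ⟨M, hM0, hM⟩ := ha.norm_le
  -- One factor absorbs ε⁻¹; the other p are merely bounded.
  have hb : ∀ p : ℕ, ∀ i, ∀ x ∈ U i, ‖a i x ^ (p + 1) * (ε i)⁻¹‖ ≤ M ^ p * c := by
    intro p i x hx
    rw [norm_mul, norm_pow, pow_succ, norm_inv, Real.norm_eq_abs, Real.norm_eq_abs,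
      abs_of_pos (hε i), mul_assoc]
    have h1 : |a i x| * (ε i)⁻¹ ≤ c := by
      rw [← div_eq_mul_inv, div_le_iff₀ (hε i)]
      exact hc i x hx
    have h2 := hM i x hx
    rw [Real.norm_eq_abs] at h2
    have h3 : 0 ≤ |a i x| * (ε i)⁻¹ := mul_nonneg (abs_nonneg _) (inv_nonneg.2 (hε i).le)
    gcongr
  intro k
  induction k generalizing p with
  | zero =>
    intro _ _
    exact UnifCn.of_continuousOn ha.isOpen
      (fun i => ((ha.continuousOn i).pow _).mul continuousOn_const) (hb p)
  | succ k ih =>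
    intro hk hp
    -- Each derivative removes one factor. As k ≤ p, at least one factor remains to absorb ε⁻¹.
    obtain ⟨q, rfl⟩ : ∃ q, p = q + 1 := ⟨p - 1, by omega⟩
    have ha1 : UnifCn (k + 1) U a := ha.of_le hk
    have hd : ∀ i, ∀ x ∈ U i, HasFDerivAt (fun x => a i x ^ (q + 1 + 1) * (ε i)⁻¹)
        ((a i x ^ (q + 1) * (ε i)⁻¹) • ((q + 1 + 1 : ℕ) : ℝ) • fderiv ℝ (a i) x) x := by
      intro i x hx
      refine ((ha1.differentiableAt hx).hasFDerivAt.pow (q + 1 + 1)).mul_const (ε i)⁻¹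
        |>.congr_fderiv ?_
      ext v
      simp only [Nat.add_sub_cancel, nsmul_eq_mul, FunLike.coe_smul, Pi.smul_apply, smul_eq_mul]
      ring
    refine UnifCn.of_fderiv (fun i x hx =>
      (hd i x hx).differentiableAt.differentiableWithinAt) (hb _) ?_
    refine UnifCn.congr ?_ fun i x hx => (hd i x hx).fderiv
    exact (ih q (by omega) (by omega)).smul
      (ha1.derivative.const_smul (c := fun _ => ((q + 1 + 1 : ℕ) : ℝ)) fun _ => le_rfl)

/-- The direction of the slow angle. -/
abbrev slowDir : PhaseSpace := phaseBasis (Sum.inl 0)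

theorem isPeriodic_fderiv {S : Set ActionSpace} (hS : IsOpen S) {f : PhaseSpace → ℝ}
    (hf : IsPeriodic S f) (v : PhaseSpace) : IsPeriodic S (fun x => fderiv ℝ f x v) := by
  intro x hx k
  have h : (fun y => f (y + latticeVec k)) =ᶠ[nhds x] f := by
    filter_upwards [(isOpen_univ.prod hS).mem_nhds hx] with y hy using hf y hy k
  have h1 := h.fderiv_eq (𝕜 := ℝ)
  rw [fderiv_comp_add_right] at h1
  exact congrArg (fun A : PhaseSpace →L[ℝ] ℝ => A v) h1

/-- The iterates of `∂_{θ₁}` followed by the primitive in `θ₂`, applied to `f`. -/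
noncomputable def slowIterate (f : PhaseSpace → ℝ) : ℕ → PhaseSpace → ℝ
  | 0 => f
  | j + 1 => anglePrimitive fun x => fderiv ℝ (slowIterate f j) x slowDir

/-- The partial derivative `∂h/∂I_k`. -/
noncomputable def freq (h : ActionSpace → ℝ) (k : Fin 2) (I : ActionSpace) : ℝ :=
  fderiv ℝ h I (actionBasis k)

/-- The ratio of the slow frequency to the fast frequency. -/
noncomputable def freqRatio (h : ActionSpace → ℝ) (I : ActionSpace) : ℝ :=
  freq h 0 I * (freq h 1 I)⁻¹

/-- The approximate solution `χ` of the homological equation `ω · ∂_θ χ = average f - f`, a partial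
sum of the Neumann series in the frequency ratio. -/
noncomputable def generator (n : ℕ) (h : ActionSpace → ℝ) (f : PhaseSpace → ℝ) (x : PhaseSpace) :
    ℝ :=
  -∑ j ∈ Finset.range (n + 1),
    ((-freqRatio h x.2) ^ j * (freq h 1 x.2)⁻¹) * anglePrimitive (slowIterate f j) x

section

variable {n N : ℕ} {U : ι → Set ActionSpace} {f : ι → PhaseSpace → ℝ} {h : ι → ActionSpace → ℝ}
  {c : ℝ}

theorem UnifCn.comp_action {φ : ι → ActionSpace → F} (hφ : UnifCn n U φ) :
    UnifCn n (fun i => torusTimes (U i)) (fun i x => φ i x.2) :=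
  hφ.comp (UnifDerivCn.clm (fun i => isOpen_univ.prod (hφ.isOpen i))
    (ContinuousLinearMap.snd ℝ (Fin 2 → ℝ) (Fin 2 → ℝ))) fun _ _ hx => hx.2

theorem UnifCn.fderiv_apply {φ : ι → E → F} {U : ι → Set E} (hφ : UnifCn (n + 1) U φ) (v : E) :
    UnifCn n U (fun i x => fderiv ℝ (φ i) x v) :=
  hφ.derivative.clm (ContinuousLinearMap.apply ℝ F v)

theorem unifCn_slowIterate {j : ℕ} (hf : UnifCn (n + j) (fun i => torusTimes (U i)) f) :
    UnifCn n (fun i => torusTimes (U i)) (fun i => slowIterate (f i) j) := by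
  induction j generalizing n with
  | zero => exact hf
  | succ j ih =>
    have h1 : UnifCn (n + 1) (fun i => torusTimes (U i)) (fun i => slowIterate (f i) j) :=
      ih (by rwa [add_assoc, add_comm 1 j])
    exact unifCn_angleIntegral (h1.fderiv_apply slowDir) _ _

theorem isPeriodic_slowIterate {S : Set ActionSpace} (hS : IsOpen S) {f : PhaseSpace → ℝ}
    (hf : IsPeriodic S f) (j : ℕ) : IsPeriodic S (slowIterate f j) := by
  induction j with
  | zero => exact hf
  | succ j ih => exact isPeriodic_angleIntegral (isPeriodic_fderiv hS ih _) _ _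

theorem unifCn_freq (hh : UnifCn (n + 1) U h) (k : Fin 2) :
    UnifCn n U (fun i => freq (h i) k) :=
  hh.fderiv_apply _

theorem unifCn_freqRatio (hh : UnifCn (n + 1) U h) (hc : 0 < c)
    (hω : ∀ i, ∀ I ∈ U i, c ≤ freq (h i) 1 I) : UnifCn n U (fun i => freqRatio (h i)) :=
  (unifCn_freq hh 0).mul ((unifCn_freq hh 1).inv hc hω)

theorem unifCn_coefficient (hh : UnifCn (n + 1) U h) (hc : 0 < c)
    (hω : ∀ i, ∀ I ∈ U i, c ≤ freq (h i) 1 I) (j : ℕ) :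
    UnifCn n U (fun i I => (-freqRatio (h i) I) ^ j * (freq (h i) 1 I)⁻¹) :=
  ((unifCn_freqRatio hh hc hω).neg.pow j).mul ((unifCn_freq hh 1).inv hc hω)

/-- The j-th term of the series spends j derivatives of f in θ₁, the primitives themselves none; the
frequencies cost one derivative of h. -/
theorem unifCn_generator (hh : UnifCn (N + 1) U h) (hc : 0 < c)
    (hω : ∀ i, ∀ I ∈ U i, c ≤ freq (h i) 1 I)
    (hf : UnifCn (N + n) (fun i => torusTimes (U i)) f) :
    UnifCn N (fun i => torusTimes (U i)) (fun i => generator n (h i) (f i)) := by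
  refine (UnifCn.sum (Finset.range (n + 1)) hf.isOpen fun j hj => ?_).neg
  have hj' := Finset.mem_range.1 hj
  exact (unifCn_coefficient hh hc hω j).comp_action.mul (unifCn_angleIntegral
    (unifCn_slowIterate (hf.of_le (by omega : N + j ≤ N + n))) _ _)

theorem isPeriodic_generator {S : Set ActionSpace} (hS : IsOpen S) (h : ActionSpace → ℝ)
    {f : PhaseSpace → ℝ} (hf : IsPeriodic S f) (n : ℕ) : IsPeriodic S (generator n h f) := by
  intro x hx k
  have h1 : (x + latticeVec k).2 = x.2 := by simp [latticeVec]
  simp only [generator, h1]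
  congr 1
  refine Finset.sum_congr rfl fun j _ => ?_
  congr 1
  exact isPeriodic_angleIntegral (isPeriodic_slowIterate hS hf j) _ _ x hx k

/-- The homological equation, with its error term. -/
theorem homological_equation (hh : UnifCn 2 U h) (hc : 0 < c)
    (hω : ∀ i, ∀ I ∈ U i, c ≤ freq (h i) 1 I)
    (hf : UnifCn (n + 1) (fun i => torusTimes (U i)) f) (hp : ∀ i, IsPeriodic (U i) (f i))
    {i : ι} {x : PhaseSpace} (hx : x ∈ torusTimes (U i)) :
    freq (h i) 0 x.2 * fderiv ℝ (generator n (h i) (f i)) x slowDir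
        + freq (h i) 1 x.2 * fderiv ℝ (generator n (h i) (f i)) x fastDir
        + f i x - average (f i) x
      = (-freqRatio (h i) x.2) ^ (n + 1) * slowIterate (f i) (n + 1) x := by
  have hB : ∀ j ≤ n, UnifCn 1 (fun i => torusTimes (U i)) (fun i => slowIterate (f i) j) :=
    fun j hj => unifCn_slowIterate (hf.of_le (by omega : 1 + j ≤ n + 1))
  have hBp : ∀ j i, IsPeriodic (U i) (slowIterate (f i) j) := fun j i =>
    isPeriodic_slowIterate (hh.isOpen i) (hp i) j
  -- The coefficients depend on the actions only, so angle derivatives fall on the primitives.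
  have hderiv : ∀ v : Fin 2 → ℝ, fderiv ℝ (generator n (h i) (f i)) x (v, 0)
      = -∑ j ∈ Finset.range (n + 1), ((-freqRatio (h i) x.2) ^ j * (freq (h i) 1 x.2)⁻¹)
        * fderiv ℝ (anglePrimitive (slowIterate (f i) j)) x (v, 0) := by
    intro v
    have h1 : ∀ j ∈ Finset.range (n + 1), HasFDerivAt
        (fun x : PhaseSpace => ((-freqRatio (h i) x.2) ^ j * (freq (h i) 1 x.2)⁻¹)
          * anglePrimitive (slowIterate (f i) j) x) _ x := fun j hj => by
      have hj' := Finset.mem_range.1 hj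
      have hC := ((unifCn_coefficient (n := 0 + 1) hh hc hω j).differentiableAt hx.2).hasFDerivAt
      have hA := ((unifCn_angleIntegral (hB j (by omega)) (-1 / 2) 1).differentiableAt
        (n := 0) hx).hasFDerivAt
      exact (hC.comp x hasFDerivAt_snd).mul hA
    have h2 : HasFDerivAt (generator n (h i) (f i)) _ x := (HasFDerivAt.fun_sum h1).neg
    rw [h2.fderiv]
    simp
  have h0 : fderiv ℝ (generator n (h i) (f i)) x slowDir
      = -∑ j ∈ Finset.range (n + 1), ((-freqRatio (h i) x.2) ^ j * (freq (h i) 1 x.2)⁻¹)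
        * slowIterate (f i) (j + 1) x := by
    rw [show slowDir = (Pi.single 0 1, 0) from rfl, hderiv]
    congr 1
    refine Finset.sum_congr rfl fun j hj => ?_
    have hj' := Finset.mem_range.1 hj
    rw [(hB j (by omega)).fderiv_angleIntegral _ _ hx]
    rfl
  have h1 : fderiv ℝ (generator n (h i) (f i)) x fastDir
      = -∑ j ∈ Finset.range (n + 1), ((-freqRatio (h i) x.2) ^ j * (freq (h i) 1 x.2)⁻¹)
        * (slowIterate (f i) j x - average (slowIterate (f i) j) x) := by
    rw [show fastDir = (Pi.single 1 1, 0) from rfl, hderiv]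
    congr 1
    refine Finset.sum_congr rfl fun j hj => ?_
    have hj' := Finset.mem_range.1 hj
    rw [← (hB j (by omega)).fderiv_anglePrimitive_fastDir (hBp j) hx]
    rfl
  -- Later iterates are primitives of zero mean, so only f itself contributes an average.
  have havg : ∀ j ≤ n, average (slowIterate (f i) j) x = if j = 0 then average (f i) x else 0 := by
    intro j hj
    cases j with
    | zero => simp [slowIterate]
    | succ j =>
      rw [if_neg (Nat.succ_ne_zero j)]
      exact ((hB j (by omega)).fderiv_apply (n := 0) slowDir).average_anglePrimitive
        (fun i => isPeriodic_fderiv (hh.isOpen i) (hBp j i) _) hx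
  have hω1 : freq (h i) 1 x.2 ≠ 0 := (hc.trans_le (hω i x.2 hx.2)).ne'
  -- The slow derivative of the j-th term cancels the fast derivative of the next one: the sum
  -- telescopes.
  have hterm : ∀ j ∈ Finset.range (n + 1),
      freq (h i) 0 x.2 * (((-freqRatio (h i) x.2) ^ j * (freq (h i) 1 x.2)⁻¹)
          * slowIterate (f i) (j + 1) x)
        + freq (h i) 1 x.2 * (((-freqRatio (h i) x.2) ^ j * (freq (h i) 1 x.2)⁻¹)
          * (slowIterate (f i) j x - average (slowIterate (f i) j) x))
      = -((-freqRatio (h i) x.2) ^ (j + 1) * slowIterate (f i) (j + 1) x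
          - (-freqRatio (h i) x.2) ^ j * slowIterate (f i) j x)
        - (if j = 0 then average (f i) x else 0) := by
    intro j hj
    have hj' := Finset.mem_range.1 hj
    rw [havg j (by omega), pow_succ, freqRatio]
    split_ifs with h
    · subst h
      field_simp
      ring
    · field_simp
      ring
  rw [h0, h1, mul_neg, mul_neg, Finset.mul_sum, Finset.mul_sum, ← neg_add,
    ← Finset.sum_add_distrib, Finset.sum_congr rfl hterm, Finset.sum_sub_distrib,
    Finset.sum_neg_distrib, Finset.sum_range_sub
      (fun j => (-freqRatio (h i) x.2) ^ j * slowIterate (f i) j x)]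
  simp only [Finset.sum_ite_eq', Finset.mem_range, Nat.succ_pos, if_true, pow_zero, slowIterate]
  ring

end

end TwoStepNormalForm

/-! ### Symplectic maps from generating functions in mixed coordinates. -/

namespace TwoStepNormalForm

variable {ι : Type}

section GeneratingFunction

/-- The restriction of a covector to the angle directions. -/
noncomputable def anglePart : (PhaseSpace →L[ℝ] ℝ) →L[ℝ] (Fin 2 → ℝ) :=
  ContinuousLinearMap.pi fun k => ContinuousLinearMap.apply ℝ ℝ (phaseBasis (Sum.inl k))

/-- The restriction of a covector to the action directions. -/
noncomputable def actionPart : (PhaseSpace →L[ℝ] ℝ) →L[ℝ] (Fin 2 → ℝ) :=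
  ContinuousLinearMap.pi fun k => ContinuousLinearMap.apply ℝ ℝ (phaseBasis (Sum.inr k))

@[simp] theorem anglePart_apply (A : PhaseSpace →L[ℝ] ℝ) (k : Fin 2) :
    anglePart A k = A (phaseBasis (Sum.inl k)) := rfl

@[simp] theorem actionPart_apply (A : PhaseSpace →L[ℝ] ℝ) (k : Fin 2) :
    actionPart A k = A (phaseBasis (Sum.inr k)) := rfl

theorem norm_phaseBasis (j : Fin 2 ⊕ Fin 2) : ‖phaseBasis j‖ = 1 := by
  cases j <;> simp [phaseBasis, Prod.norm_def, Pi.norm_single]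

theorem norm_anglePart_le (A : PhaseSpace →L[ℝ] ℝ) : ‖anglePart A‖ ≤ ‖A‖ := by
  refine (pi_norm_le_iff_of_nonneg (norm_nonneg A)).2 fun k => ?_
  simpa [norm_phaseBasis] using A.le_opNorm (phaseBasis (Sum.inl k))

theorem norm_actionPart_le (A : PhaseSpace →L[ℝ] ℝ) : ‖actionPart A‖ ≤ ‖A‖ := by
  refine (pi_norm_le_iff_of_nonneg (norm_nonneg A)).2 fun k => ?_
  simpa [norm_phaseBasis] using A.le_opNorm (phaseBasis (Sum.inr k))

/-- The map `(q, P) ↦ (q, P + δ ∂_q χ (q, P))`. -/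
noncomputable def oldCoords (δ : ℝ) (χ : PhaseSpace → ℝ) (x : PhaseSpace) : PhaseSpace :=
  x + δ • ((0 : Fin 2 → ℝ), anglePart (fderiv ℝ χ x))

/-- The map `(q, P) ↦ (q + δ ∂_P χ (q, P), P)`. -/
noncomputable def newCoords (δ : ℝ) (χ : PhaseSpace → ℝ) (x : PhaseSpace) : PhaseSpace :=
  x + δ • (actionPart (fderiv ℝ χ x), (0 : Fin 2 → ℝ))

variable {δ : ℝ} {χ : PhaseSpace → ℝ} {x : PhaseSpace}

theorem hasFDerivAt_oldCoords (h : DifferentiableAt ℝ (fderiv ℝ χ) x) :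
    HasFDerivAt (oldCoords δ χ) (ContinuousLinearMap.id ℝ PhaseSpace
      + δ • (ContinuousLinearMap.inr ℝ (Fin 2 → ℝ) (Fin 2 → ℝ)).comp
        (anglePart.comp (fderiv ℝ (fderiv ℝ χ) x))) x :=
  (hasFDerivAt_id x).add
    (((ContinuousLinearMap.inr ℝ (Fin 2 → ℝ) (Fin 2 → ℝ)).hasFDerivAt.comp x
      (anglePart.hasFDerivAt.comp x h.hasFDerivAt)).const_smul δ)

theorem hasFDerivAt_newCoords (h : DifferentiableAt ℝ (fderiv ℝ χ) x) :
    HasFDerivAt (newCoords δ χ) (ContinuousLinearMap.id ℝ PhaseSpace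
      + δ • (ContinuousLinearMap.inl ℝ (Fin 2 → ℝ) (Fin 2 → ℝ)).comp
        (actionPart.comp (fderiv ℝ (fderiv ℝ χ) x))) x :=
  (hasFDerivAt_id x).add
    (((ContinuousLinearMap.inl ℝ (Fin 2 → ℝ) (Fin 2 → ℝ)).hasFDerivAt.comp x
      (actionPart.hasFDerivAt.comp x h.hasFDerivAt)).const_smul δ)

theorem norm_fderiv_oldCoords_sub_le (h : DifferentiableAt ℝ (fderiv ℝ χ) x) {M : ℝ}
    (hδ : 0 ≤ δ) (hM : ‖fderiv ℝ (fderiv ℝ χ) x‖ ≤ M) (hδM : δ * M ≤ 1 / 2) :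
    ‖fderiv ℝ (oldCoords δ χ) x - ContinuousLinearMap.id ℝ PhaseSpace‖ ≤ 1 / 2 := by
  rw [(hasFDerivAt_oldCoords h).fderiv, add_sub_cancel_left]
  refine (ContinuousLinearMap.opNorm_le_bound _ (mul_nonneg hδ
    (norm_nonneg (fderiv ℝ (fderiv ℝ χ) x)))
    fun v => ?_).trans ((mul_le_mul_of_nonneg_left hM hδ).trans hδM)
  simp only [FunLike.coe_smul, Pi.smul_apply, ContinuousLinearMap.coe_comp, Function.comp_apply,
    ContinuousLinearMap.inr_apply, norm_smul, Prod.norm_def, norm_zero, Real.norm_of_nonneg hδ,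
    mul_assoc]
  refine mul_le_mul_of_nonneg_left ?_ hδ
  rw [max_eq_right (norm_nonneg _)]
  exact (norm_anglePart_le _).trans (ContinuousLinearMap.le_opNorm _ v)

theorem norm_fderiv_newCoords_sub_le (h : DifferentiableAt ℝ (fderiv ℝ χ) x) {M : ℝ}
    (hδ : 0 ≤ δ) (hM : ‖fderiv ℝ (fderiv ℝ χ) x‖ ≤ M) (hδM : δ * M ≤ 1 / 2) :
    ‖fderiv ℝ (newCoords δ χ) x - ContinuousLinearMap.id ℝ PhaseSpace‖ ≤ 1 / 2 := by
  rw [(hasFDerivAt_newCoords h).fderiv, add_sub_cancel_left]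
  refine (ContinuousLinearMap.opNorm_le_bound _ (mul_nonneg hδ
    (norm_nonneg (fderiv ℝ (fderiv ℝ χ) x)))
    fun v => ?_).trans ((mul_le_mul_of_nonneg_left hM hδ).trans hδM)
  simp only [FunLike.coe_smul, Pi.smul_apply, ContinuousLinearMap.coe_comp, Function.comp_apply,
    ContinuousLinearMap.inl_apply, norm_smul, Prod.norm_def, norm_zero, Real.norm_of_nonneg hδ,
    mul_assoc]
  refine mul_le_mul_of_nonneg_left ?_ hδ
  rw [max_eq_left (norm_nonneg _)]
  exact (norm_actionPart_le _).trans (ContinuousLinearMap.le_opNorm _ v)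

theorem clm_apply_eq_sum (A : PhaseSpace →L[ℝ] ℝ) (v : PhaseSpace) :
    A v = ∑ k, (v.1 k * anglePart A k + v.2 k * actionPart A k) := by
  have hv : v = v.1 0 • phaseBasis (Sum.inl 0) + v.1 1 • phaseBasis (Sum.inl 1)
      + v.2 0 • phaseBasis (Sum.inr 0) + v.2 1 • phaseBasis (Sum.inr 1) := by
    ext i <;> fin_cases i <;> simp [phaseBasis]
  conv_lhs => rw [hv]
  simp only [map_add, map_smul, smul_eq_mul, Fin.sum_univ_two, anglePart_apply, actionPart_apply]
  ring

/-- Both maps pull back the symplectic form to the same form. -/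
theorem symplecticForm_oldCoords (h : ContDiffAt ℝ 2 χ x) (u v : PhaseSpace) :
    symplecticForm (fderiv ℝ (oldCoords δ χ) x u) (fderiv ℝ (oldCoords δ χ) x v)
      = symplecticForm (fderiv ℝ (newCoords δ χ) x u) (fderiv ℝ (newCoords δ χ) x v) := by
  have hd : DifferentiableAt ℝ (fderiv ℝ χ) x :=
    (h.fderiv_right (m := 1) (by norm_num)).differentiableAt (by norm_num)
  -- The two pullbacks differ by a multiple of d(dχ), which vanishes by the symmetry of the Hessian.
  have hsymm := (h.isSymmSndFDerivAt (by simp)) u v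
  rw [clm_apply_eq_sum, clm_apply_eq_sum (fderiv ℝ (fderiv ℝ χ) x v)] at hsymm
  rw [(hasFDerivAt_oldCoords hd).fderiv, (hasFDerivAt_newCoords hd).fderiv]
  simp only [symplecticForm, Fin.sum_univ_two, add_apply, FunLike.coe_smul,
    Pi.smul_apply, ContinuousLinearMap.coe_comp, Function.comp_apply,
    ContinuousLinearMap.inl_apply, ContinuousLinearMap.inr_apply, ContinuousLinearMap.coe_id',
    id_eq, Prod.fst_add, Prod.snd_add, Prod.smul_fst, Prod.smul_snd, Pi.add_apply, smul_eq_mul,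
    smul_zero, add_zero, Pi.zero_apply] at hsymm ⊢
  linear_combination -δ * hsymm

theorem latticeVec_fst_snd (x : PhaseSpace) (k : Fin 2 → ℤ) : (x + latticeVec k).2 = x.2 := by
  simp [latticeVec]

theorem add_latticeVec_mem {S : Set ActionSpace} (hx : x ∈ torusTimes S) (k : Fin 2 → ℤ) :
    x + latticeVec k ∈ torusTimes S :=
  ⟨trivial, by rw [latticeVec_fst_snd]; exact hx.2⟩

theorem isOpen_of_torusTimes {S : Set ActionSpace} (h : IsOpen (torusTimes S)) : IsOpen S := by
  have h1 := isOpenMap_snd _ h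
  rwa [torusTimes, Set.snd_image_prod Set.univ_nonempty] at h1

theorem fderiv_add_latticeVec {S : Set ActionSpace} (hS : IsOpen S) (hχ : IsPeriodic S χ)
    (hx : x ∈ torusTimes S) (k : Fin 2 → ℤ) : fderiv ℝ χ (x + latticeVec k) = fderiv ℝ χ x :=
  ContinuousLinearMap.ext fun v => isPeriodic_fderiv hS hχ v x hx k

end GeneratingFunction

/-- `Φ` is a symplectic map of class `C^n`, injective and commuting with the lattice translations,
within `d` of the identity on `𝕋² × V`. Intended for open `V`. -/
structure IsNearIdSymplectic (n : ℕ) (V : Set ActionSpace) (d : ℝ) (Φ : PhaseSpace → PhaseSpace) :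
    Prop where
  contDiffOn : ContDiffOn ℝ n Φ (torusTimes V)
  norm_sub_le : ∀ x ∈ torusTimes V, ‖Φ x - x‖ ≤ d
  equivariant : ∀ x ∈ torusTimes V, ∀ k : Fin 2 → ℤ, Φ (x + latticeVec k) = Φ x + latticeVec k
  injOn : Set.InjOn Φ (torusTimes V)
  symplectic : ∀ x ∈ torusTimes V, ∀ u v : PhaseSpace,
    symplecticForm (fderiv ℝ Φ x u) (fderiv ℝ Φ x v) = symplecticForm u v

theorem mem_torusTimes_of_near {S S' : Set ActionSpace} {d : ℝ}
    (h : ∀ P ∈ S, ∀ P', ‖P' - P‖ ≤ d → P' ∈ S') {x y : PhaseSpace} (hx : x ∈ torusTimes S)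
    (hy : ‖y - x‖ ≤ d) : y ∈ torusTimes S' :=
  ⟨trivial, h _ hx.2 _ ((norm_snd_le (y - x)).trans hy)⟩

/-- Equivariance turns injectivity of the lift into injectivity on the torus, and unique
differentiability of S identifies derivatives within S with those on the open set V. -/
theorem IsNearIdSymplectic.isSymplecticEmbedding {n : ℕ} {V S S' : Set ActionSpace} {d : ℝ}
    {Φ : PhaseSpace → PhaseSpace} (hΦ : IsNearIdSymplectic (n + 1) V d Φ) (hV : IsOpen V)
    (hSV : S ⊆ V) (hS : UniqueDiffOn ℝ S) (h : ∀ P ∈ S, ∀ P', ‖P' - P‖ ≤ d → P' ∈ S') :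
    IsSymplecticEmbedding (n + 1) S S' Φ := by
  have hsub : torusTimes S ⊆ torusTimes V := Set.prod_mono le_rfl hSV
  refine ⟨fun x hx => mem_torusTimes_of_near h hx (hΦ.norm_sub_le x (hsub hx)),
    fun x hx => hΦ.equivariant x (hsub hx), hΦ.contDiffOn.mono hsub, ?_, ?_⟩
  · rintro x hx y hy ⟨k, hk⟩
    refine ⟨k, hΦ.injOn (hsub hy) (hsub (add_latticeVec_mem hx k)) ?_⟩
    rw [hk, hΦ.equivariant x (hsub hx) k]
  · intro x hx u v
    have hd : DifferentiableAt ℝ Φ x := (hΦ.contDiffOn.differentiableOn (by simp)).differentiableAt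
      ((isOpen_univ.prod hV).mem_nhds (hsub hx))
    have hu : UniqueDiffOn ℝ (torusTimes S) := uniqueDiffOn_univ.prod hS
    rw [hd.fderivWithin (hu x hx)]
    exact hΦ.symplectic x (hsub hx) u v

theorem IsNearIdSymplectic.comp {n₁ n₂ : ℕ} (hn : n₂ ≤ n₁) {V₁ V₂ : Set ActionSpace} {d₁ d₂ : ℝ}
    {Φ₁ Φ₂ : PhaseSpace → PhaseSpace} (h₁ : IsNearIdSymplectic (n₁ + 1) V₁ d₁ Φ₁)
    (h₂ : IsNearIdSymplectic (n₂ + 1) V₂ d₂ Φ₂) (hV₁ : IsOpen V₁) (hV₂ : IsOpen V₂)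
    (h : ∀ P ∈ V₂, ∀ P', ‖P' - P‖ ≤ d₂ → P' ∈ V₁) :
    IsNearIdSymplectic (n₂ + 1) V₂ (d₁ + d₂) (Φ₁ ∘ Φ₂) := by
  have hmaps : Set.MapsTo Φ₂ (torusTimes V₂) (torusTimes V₁) := fun x hx =>
    mem_torusTimes_of_near h hx (h₂.norm_sub_le x hx)
  have hle : ((n₂ + 1 : ℕ) : WithTop ℕ∞) ≤ (n₁ + 1 : ℕ) := by exact_mod_cast Nat.succ_le_succ hn
  refine ⟨(h₁.contDiffOn.of_le hle).comp h₂.contDiffOn hmaps, fun x hx => ?_, fun x hx k => ?_,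
    h₁.injOn.comp h₂.injOn hmaps, fun x hx u v => ?_⟩
  · have e : (Φ₁ ∘ Φ₂) x - x = (Φ₁ (Φ₂ x) - Φ₂ x) + (Φ₂ x - x) := by simp
    rw [e]
    exact (norm_add_le _ _).trans
      (add_le_add (h₁.norm_sub_le _ (hmaps hx)) (h₂.norm_sub_le x hx))
  · simp only [Function.comp_apply, h₂.equivariant x hx k, h₁.equivariant _ (hmaps hx) k]
  · have hd₁ : DifferentiableAt ℝ Φ₁ (Φ₂ x) := (h₁.contDiffOn.differentiableOn
      (by simp)).differentiableAt ((isOpen_univ.prod hV₁).mem_nhds (hmaps hx))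
    have hd₂ : DifferentiableAt ℝ Φ₂ x := (h₂.contDiffOn.differentiableOn
      (by simp)).differentiableAt ((isOpen_univ.prod hV₂).mem_nhds hx)
    rw [fderiv_comp x hd₁ hd₂]
    exact (h₁.symplectic _ (hmaps hx) _ _).trans (h₂.symplectic x hx u v)

/-! ### Construction of the generated map. -/

section Step

variable {n : ℕ} {V : ι → Set ActionSpace} {χ : ι → PhaseSpace → ℝ} {δ : ι → ℝ} {M D : ℝ}

theorem unifDerivCn_oldCoords (hχ : UnifCn (n + 1) (fun i => torusTimes (V i)) χ)
    (hδ : ∀ i, |δ i| ≤ D) :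
    UnifDerivCn n (fun i => torusTimes (V i)) (fun i => oldCoords (δ i) (χ i)) :=
  (UnifDerivCn.clm hχ.isOpen (ContinuousLinearMap.id ℝ PhaseSpace)).add
    (((hχ.derivative.clm ((ContinuousLinearMap.inr ℝ (Fin 2 → ℝ) (Fin 2 → ℝ)).comp
      anglePart)).const_smul hδ).unifDerivCn)

theorem unifDerivCn_newCoords (hχ : UnifCn (n + 1) (fun i => torusTimes (V i)) χ)
    (hδ : ∀ i, |δ i| ≤ D) :
    UnifDerivCn n (fun i => torusTimes (V i)) (fun i => newCoords (δ i) (χ i)) :=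
  (UnifDerivCn.clm hχ.isOpen (ContinuousLinearMap.id ℝ PhaseSpace)).add
    (((hχ.derivative.clm ((ContinuousLinearMap.inl ℝ (Fin 2 → ℝ) (Fin 2 → ℝ)).comp
      actionPart)).const_smul hδ).unifDerivCn)

/-- The change of variables generated by `δ χ` in mixed coordinates `(q, P)`: the family `Θ`
passes from the new coordinates to the mixed ones, `oldCoords` from these to the old ones. -/
theorem exists_generated_map (hχ : UnifCn (n + 2) (fun i => torusTimes (V i)) χ)
    (hper : ∀ i, IsPeriodic (V i) (χ i)) (hV : ∀ i, Convex ℝ (V i)) (hδ0 : ∀ i, 0 ≤ δ i)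
    (hδ : ∀ i, |δ i| ≤ D) (hM1 : ∀ i, ∀ x ∈ torusTimes (V i), ‖fderiv ℝ (χ i) x‖ ≤ M)
    (hM2 : ∀ i, ∀ x ∈ torusTimes (V i), ‖fderiv ℝ (fderiv ℝ (χ i)) x‖ ≤ M)
    (hδM : ∀ i, δ i * M ≤ 1 / 2) :
    ∃ Θ : ι → PhaseSpace → PhaseSpace,
      UnifDerivCn (n + 1) (fun i => torusTimes (V i)) Θ ∧
      (∀ i, Set.MapsTo (Θ i) (torusTimes (V i)) (torusTimes (V i))) ∧
      (∀ i, ∀ x ∈ torusTimes (V i), newCoords (δ i) (χ i) (Θ i x) = x) ∧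
      ∀ i, IsNearIdSymplectic (n + 1) (V i) (δ i * M) (oldCoords (δ i) (χ i) ∘ Θ i) := by
  have hconv : ∀ i, Convex ℝ (torusTimes (V i)) := fun i => convex_univ.prod (hV i)
  have hd2 : ∀ i, ∀ x ∈ torusTimes (V i), DifferentiableAt ℝ (fderiv ℝ (χ i)) x :=
    fun i x hx => hχ.derivative.differentiableAt hx
  have hold := fun i x hx => norm_fderiv_oldCoords_sub_le (hd2 i x hx) (hδ0 i) (hM2 i x hx) (hδM i)
  have hnew := fun i x hx => norm_fderiv_newCoords_sub_le (hd2 i x hx) (hδ0 i) (hM2 i x hx) (hδM i)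
  have hex : ∀ i x, ∃ y, x ∈ torusTimes (V i) →
      y ∈ torusTimes (V i) ∧ newCoords (δ i) (χ i) y = x := by
    intro i x
    by_cases hx : x ∈ torusTimes (V i)
    swap
    · exact ⟨x, fun h => absurd h hx⟩
    have hmem : ∀ q : Fin 2 → ℝ, (q, x.2) ∈ torusTimes (V i) := fun q => ⟨trivial, hx.2⟩
    -- `newCoords` fixes P, so it is inverted by a contraction in q over all of ℝ²; the action
    -- domain does not shrink.
    obtain ⟨q, hq⟩ := exists_add_eq
      (u := fun q : Fin 2 → ℝ => δ i • actionPart (fderiv ℝ (χ i) (q, x.2))) (fun q q' => by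
        have h := (hconv i).norm_image_sub_le_of_norm_hasFDerivWithin_le
          (f := fun z => newCoords (δ i) (χ i) z - z)
          (f' := fun z => fderiv ℝ (newCoords (δ i) (χ i)) z - ContinuousLinearMap.id ℝ PhaseSpace)
          (fun z hz => ((hasFDerivAt_newCoords (hd2 i z hz)).differentiableAt.hasFDerivAt.sub
            (hasFDerivAt_id z)).hasFDerivWithinAt) (hnew i) (hmem q') (hmem q)
        refine le_trans ?_ (h.trans (le_of_eq ?_))
        · refine le_trans (le_of_eq ?_) (norm_fst_le _)
          simp [newCoords]
        · simp [Prod.norm_def]) x.1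
    refine ⟨(q, x.2), fun _ => ⟨hmem q, ?_⟩⟩
    refine Prod.ext ?_ ?_
    · simpa [newCoords] using hq
    · simp [newCoords]
  choose Θ hΘ using hex
  have hmaps : ∀ i, Set.MapsTo (Θ i) (torusTimes (V i)) (torusTimes (V i)) :=
    fun i x hx => (hΘ i x hx).1
  have hinv : ∀ i, ∀ x ∈ torusTimes (V i), newCoords (δ i) (χ i) (Θ i x) = x :=
    fun i x hx => (hΘ i x hx).2
  have hN := unifDerivCn_newCoords (n := n + 1) hχ hδ
  have hO := unifDerivCn_oldCoords (n := n + 1) hχ hδ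
  have hT : UnifDerivCn (n + 1) (fun i => torusTimes (V i)) Θ :=
    hN.rightInverse hconv hnew hmaps hinv
  refine ⟨Θ, hT, hmaps, hinv, fun i => ⟨(hO.contDiffOn i).comp (hT.contDiffOn i) (hmaps i),
    fun x hx => ?_, fun x hx k => ?_, fun x hx y hy hxy => ?_, fun x hx u v => ?_⟩⟩
  · have e : (oldCoords (δ i) (χ i) ∘ Θ i) x - x = δ i •
        (-actionPart (fderiv ℝ (χ i) (Θ i x)), anglePart (fderiv ℝ (χ i) (Θ i x))) := by
      have h : oldCoords (δ i) (χ i) (Θ i x) - newCoords (δ i) (χ i) (Θ i x) = δ i •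
          (-actionPart (fderiv ℝ (χ i) (Θ i x)), anglePart (fderiv ℝ (χ i) (Θ i x))) := by
        rw [oldCoords, newCoords, add_sub_add_left_eq_sub, ← smul_sub]
        simp
      rwa [hinv i x hx] at h
    rw [e, norm_smul, Real.norm_of_nonneg (hδ0 i), Prod.norm_def, norm_neg]
    refine mul_le_mul_of_nonneg_left (max_le ?_ ?_) (hδ0 i)
    · exact (norm_actionPart_le _).trans (hM1 i _ (hmaps i hx))
    · exact (norm_anglePart_le _).trans (hM1 i _ (hmaps i hx))
  -- Both sides have the same image under the injective map `newCoords`.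
  · have h1 : Θ i (x + latticeVec k) = Θ i x + latticeVec k := by
      have hx' := add_latticeVec_mem hx k
      have h := dist_le_two_mul_of_fderiv_near_id (hconv i) (fun z hz => hN.differentiableAt hz)
        (hnew i) (hmaps i hx') (add_latticeVec_mem (hmaps i hx) k)
      have h2 : newCoords (δ i) (χ i) (Θ i x + latticeVec k) = x + latticeVec k := by
        conv_rhs => rw [← hinv i x hx]
        simp only [newCoords, fderiv_add_latticeVec (isOpen_of_torusTimes (hχ.isOpen i)) (hper i)
          (hmaps i hx) k]
        abel
      rw [hinv i _ hx', h2, sub_self, norm_zero, mul_zero] at h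
      exact sub_eq_zero.1 (norm_le_zero_iff.1 h)
    simp only [Function.comp_apply, h1, oldCoords,
      fderiv_add_latticeVec (isOpen_of_torusTimes (hχ.isOpen i)) (hper i) (hmaps i hx) k]
    abel
  · have h := dist_le_two_mul_of_fderiv_near_id (hconv i) (fun z hz => hO.differentiableAt hz)
      (hold i) (hmaps i hx) (hmaps i hy)
    have hxy' : oldCoords (δ i) (χ i) (Θ i x) = oldCoords (δ i) (χ i) (Θ i y) := hxy
    rw [hxy', sub_self, norm_zero, mul_zero] at h
    rw [← hinv i x hx, ← hinv i y hy, sub_eq_zero.1 (norm_le_zero_iff.1 h)]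
  · have hT1 := (hT.differentiableAt hx)
    have hc : ContDiffAt ℝ 2 (χ i) (Θ i x) := ((hχ.contDiffOn i).contDiffAt
      ((hχ.isOpen i).mem_nhds (hmaps i hx))).of_le (by exact_mod_cast (by omega : 2 ≤ n + 2))
    rw [fderiv_comp x (hO.differentiableAt (hmaps i hx)) hT1]
    -- The pullback by `oldCoords` is replaced by that by `newCoords`, and `newCoords` after Θ is
    -- the identity.
    refine (symplecticForm_oldCoords hc _ _).trans ?_
    have h1 : (fderiv ℝ (newCoords (δ i) (χ i)) (Θ i x)).comp (fderiv ℝ (Θ i) x)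
        = ContinuousLinearMap.id ℝ PhaseSpace := by
      rw [← fderiv_comp x (hN.differentiableAt (hmaps i hx)) hT1]
      have h2 : (newCoords (δ i) (χ i) ∘ Θ i) =ᶠ[nhds x] id := by
        filter_upwards [(hχ.isOpen i).mem_nhds hx] with y hy using hinv i y hy
      rw [h2.fderiv_eq, fderiv_id]
    have h2 := fun z => congrArg (fun A : PhaseSpace →L[ℝ] PhaseSpace => A z) h1
    simp only [ContinuousLinearMap.coe_comp, Function.comp_apply, ContinuousLinearMap.coe_id',
      id_eq] at h2
    exact congrArg₂ symplecticForm (h2 u) (h2 v)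

end Step

end TwoStepNormalForm

/-! ### One averaging step. -/

namespace TwoStepNormalForm

variable {ι : Type}

theorem fderiv_apply_eq_freq (h : ActionSpace → ℝ) (I v : ActionSpace) :
    fderiv ℝ h I v = v 0 * freq h 0 I + v 1 * freq h 1 I := by
  have hv : v = v 0 • actionBasis 0 + v 1 • actionBasis 1 := by
    ext i
    fin_cases i <;> simp [actionBasis]
  conv_lhs => rw [hv]
  simp only [map_add, map_smul, smul_eq_mul, freq]

/-- One step of the normal form: the perturbation `δ f` of `h + ε g` is replaced by its average, up
to a perturbation of size `δ ε`. -/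
theorem exists_normalForm_step {n : ℕ} {U V : ι → Set ActionSpace} {h : ι → ActionSpace → ℝ}
    {f g : ι → PhaseSpace → ℝ} {ε δ : ι → ℝ} {c c' M : ℝ}
    (hh : UnifCn (n + 3) U h) (hc : 0 < c) (hω : ∀ i, ∀ I ∈ U i, c ≤ freq (h i) 1 I)
    (hε : ∀ i, 0 < ε i) (hε1 : ∀ i, ε i ≤ 1) (hδ : ∀ i, 0 < δ i) (hδε : ∀ i, δ i ≤ ε i)
    (hω0 : ∀ i, ∀ I ∈ U i, |freq (h i) 0 I| ≤ c' * ε i)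
    (hf : UnifCn (2 * n + 3) (fun i => torusTimes (U i)) f) (hfp : ∀ i, IsPeriodic (U i) (f i))
    (hg : UnifCn (n + 1) (fun i => torusTimes (U i)) g) (hgp : ∀ i, IsPeriodic (U i) (g i))
    (hV : ∀ i, Convex ℝ (V i)) (hVo : ∀ i, IsOpen (V i)) (hM : 0 ≤ M)
    (hM1 : ∀ i, ∀ x ∈ torusTimes (U i), ‖fderiv ℝ (generator n (h i) (f i)) x‖ ≤ M)
    (hM2 : ∀ i, ∀ x ∈ torusTimes (U i), ‖fderiv ℝ (fderiv ℝ (generator n (h i) (f i))) x‖ ≤ M)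
    (hδM : ∀ i, δ i * M ≤ 1 / 2)
    (hVU : ∀ i, ∀ P ∈ V i, ∀ P', ‖P' - P‖ ≤ 4 * (δ i * M) → P' ∈ U i) :
    ∃ (Φ : ι → PhaseSpace → PhaseSpace) (f' : ι → PhaseSpace → ℝ),
      (∀ i, IsNearIdSymplectic (n + 1) (V i) (δ i * M) (Φ i)) ∧
      (∀ i, ∀ x ∈ torusTimes (V i),
        h i (Φ i x).2 + ε i * g i (Φ i x) + δ i * f i (Φ i x)
          = h i x.2 + ε i * g i x + δ i * average (f i) x + δ i * ε i * f' i x) ∧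
      UnifCn n (fun i => torusTimes (V i)) f' ∧ ∀ i, IsPeriodic (V i) (f' i) := by
  have hδ0 : ∀ i, 0 ≤ δ i := fun i => (hδ i).le
  have hδ1 : ∀ i, |δ i| ≤ 1 := fun i => by
    rw [abs_of_pos (hδ i)]
    exact (hδε i).trans (hε1 i)
  have hδM0 : ∀ i, 0 ≤ δ i * M := fun i => mul_nonneg (hδ0 i) hM
  have hsub : ∀ i, V i ⊆ U i := fun i P hP => hVU i P hP P (by simpa using hδM0 i)
  have hsubT : ∀ i, torusTimes (V i) ⊆ torusTimes (U i) := fun i => Set.prod_mono le_rfl (hsub i)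
  have hTo : ∀ i, IsOpen (torusTimes (V i)) := fun i => isOpen_univ.prod (hVo i)
  have hχ : UnifCn (n + 2) (fun i => torusTimes (V i)) (fun i => generator n (h i) (f i)) :=
    (unifCn_generator hh hc hω (hf.of_le (by omega))).mono_set hTo hsubT
  have hχp : ∀ i, IsPeriodic (V i) (generator n (h i) (f i)) := fun i x hx k =>
    isPeriodic_generator (hh.isOpen i) (h i) (hfp i) n x (hsubT i hx) k
  obtain ⟨Θ, hΘ, hmaps, hinv, hΦ⟩ := exists_generated_map hχ hχp hV hδ0 hδ1
    (fun i x hx => hM1 i x (hsubT i hx)) (fun i x hx => hM2 i x (hsubT i hx)) hδM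
  -- The factor 4 is the one required by the second-order quotient of h. L selects the shift in p or
  -- the shift in q.
  have hmove : ∀ L : (PhaseSpace →L[ℝ] ℝ) →L[ℝ] PhaseSpace, (∀ A, ‖L A‖ ≤ ‖A‖) → ∀ i,
      ∀ x ∈ torusTimes (V i), ∀ t : ℝ, |t| ≤ 4 →
      x + (t * δ i) • L (fderiv ℝ (generator n (h i) (f i)) x) ∈ torusTimes (U i) := by
    intro L hL i x hx t ht
    refine mem_torusTimes_of_near (hVU i) hx ?_
    rw [add_sub_cancel_left, norm_smul, norm_mul, Real.norm_eq_abs, Real.norm_eq_abs,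
      abs_of_pos (hδ i), mul_assoc]
    have h1 := (hL _).trans (hM1 i x (hsubT i hx))
    have := hδ0 i
    gcongr
  have key : ∀ φ : ι → PhaseSpace → ℝ, UnifCn (n + 1) (fun i => torusTimes (U i)) φ →
      ∀ L : (PhaseSpace →L[ℝ] ℝ) →L[ℝ] PhaseSpace, (∀ A, ‖L A‖ ≤ ‖A‖) →
      ∃ Q : ι → PhaseSpace → ℝ, UnifCn n (fun i => torusTimes (V i)) Q ∧
        ∀ i, ∀ x ∈ torusTimes (V i),
          φ i (x + δ i • L (fderiv ℝ (generator n (h i) (f i)) x)) - φ i x = δ i • Q i x := by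
    intro φ hφ L hL
    exact hφ.exists_quotient (UnifDerivCn.clm hTo (ContinuousLinearMap.id ℝ PhaseSpace))
      (((hχ.of_le (by omega : n + 1 ≤ n + 2)).derivative).clm L) hδ1
      fun i x hx t ht => hmove L hL i x hx t (by linarith)
  have hLq : ∀ A, ‖(ContinuousLinearMap.inr ℝ (Fin 2 → ℝ) (Fin 2 → ℝ)).comp anglePart A‖ ≤ ‖A‖ :=
    fun A => by simpa [Prod.norm_def] using norm_anglePart_le A
  have hLP : ∀ A, ‖(ContinuousLinearMap.inl ℝ (Fin 2 → ℝ) (Fin 2 → ℝ)).comp actionPart A‖ ≤ ‖A‖ :=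
    fun A => by simpa [Prod.norm_def] using norm_actionPart_le A
  obtain ⟨Q1, hQ1, hQ1e⟩ := key g hg _ hLq
  obtain ⟨Q2, hQ2, hQ2e⟩ := key g hg _ hLP
  obtain ⟨Q3, hQ3, hQ3e⟩ := key f (hf.of_le (by omega)) _ hLq
  obtain ⟨Q4, hQ4, hQ4e⟩ := key (fun i => average (f i))
    ((unifCn_average hf hfp).of_le (by omega)) _ hLP
  -- T is the second-order Taylor remainder of h in p; the first-order term is the ω · ∂_q χ of the
  -- homological equation.
  obtain ⟨T, hT, hTe⟩ := UnifCn.exists_quotient_sq (n := n) (hh.of_le (by omega : n + 2 ≤ n + 3))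
    (UnifDerivCn.clm hTo (ContinuousLinearMap.snd ℝ (Fin 2 → ℝ) (Fin 2 → ℝ)))
    (((hχ.of_le (by omega : n + 1 ≤ n + 2)).derivative).clm anglePart) hδ1
    fun i x hx t ht => (hmove _ hLq i x hx t ht).2
  -- The smallness of ω₁ enters here: the homological error divided by ε stays bounded in C^n.
  have hE : UnifCn n (fun i => torusTimes (V i)) (fun i x =>
      ((-freqRatio (h i) x.2) ^ (n + 1) * (ε i)⁻¹) * slowIterate (f i) (n + 1) x) := by
    refine UnifCn.mono_set ?_ hTo hsubT
    have hr := (unifCn_freqRatio (n := n) (hh.of_le (by omega : n + 1 ≤ n + 3)) hc hω).neg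
    refine (hr.pow_succ_div hε (c := c' * c⁻¹) (fun i I hI => ?_) n n le_rfl le_rfl).comp_action.mul
      (unifCn_slowIterate (hf.of_le (by omega)))
    have hpos := hc.trans_le (hω i I hI)
    rw [abs_neg, freqRatio, abs_mul, abs_inv, abs_of_pos hpos, mul_right_comm]
    exact mul_le_mul (hω0 i I hI) (inv_anti₀ hc (hω i I hI)) (inv_nonneg.2 hpos.le)
      ((abs_nonneg _).trans (hω0 i I hI))
  -- The new perturbation in mixed coordinates. Terms of size δ², divided by δε, carry the factor
  -- δ/ε ≤ 1.
  have hG : UnifCn n (fun i => torusTimes (V i)) (fun i x => (δ i * (ε i)⁻¹) • (T i x + Q3 i x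
      - Q4 i x) + (Q1 i x - Q2 i x)
      + ((-freqRatio (h i) x.2) ^ (n + 1) * (ε i)⁻¹) * slowIterate (f i) (n + 1) x) :=
    ((((hT.add hQ3).sub hQ4).const_smul (M := 1) fun i => by
      rw [abs_of_nonneg (mul_nonneg (hδ0 i) (inv_nonneg.2 (hε i).le)), ← div_eq_mul_inv]
      exact div_le_one_of_le₀ (hδε i) (hε i).le).add (hQ1.sub hQ2)).add hE
  have heq : ∀ i, ∀ x ∈ torusTimes (V i),
      h i (oldCoords (δ i) (generator n (h i) (f i)) (Θ i x)).2
        + ε i * g i (oldCoords (δ i) (generator n (h i) (f i)) (Θ i x))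
        + δ i * f i (oldCoords (δ i) (generator n (h i) (f i)) (Θ i x))
      = h i x.2 + ε i * g i x + δ i * average (f i) x
        + δ i * ε i * ((δ i * (ε i)⁻¹) • (T i (Θ i x) + Q3 i (Θ i x)
          - Q4 i (Θ i x)) + (Q1 i (Θ i x) - Q2 i (Θ i x))
          + ((-freqRatio (h i) (Θ i x).2) ^ (n + 1) * (ε i)⁻¹)
            * slowIterate (f i) (n + 1) (Θ i x)) := by
    intro i x hx
    have hy := hmaps i hx
    have hx2 := hinv i x hx
    generalize Θ i x = y at hy hx2
    have e1 : g i (oldCoords (δ i) (generator n (h i) (f i)) y) - g i y = δ i • Q1 i y :=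
      hQ1e i y hy
    have e2 : g i (newCoords (δ i) (generator n (h i) (f i)) y) - g i y = δ i • Q2 i y :=
      hQ2e i y hy
    have e3 : f i (oldCoords (δ i) (generator n (h i) (f i)) y) - f i y = δ i • Q3 i y :=
      hQ3e i y hy
    have e4 : average (f i) (newCoords (δ i) (generator n (h i) (f i)) y) - average (f i) y
        = δ i • Q4 i y := hQ4e i y hy
    have e5 : h i (oldCoords (δ i) (generator n (h i) (f i)) y).2 - h i y.2
        - δ i • fderiv ℝ (h i) y.2 (anglePart (fderiv ℝ (generator n (h i) (f i)) y))
          = δ i ^ 2 • T i y := hTe i y hy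
    have e6 : x.2 = y.2 := by
      rw [← hx2]
      simp [newCoords]
    have e7 := homological_equation (n := n) (hh.of_le (by omega : 2 ≤ n + 3)) hc hω
      (hf.of_le (by omega)) hfp (hsubT i hy)
    rw [fderiv_apply_eq_freq] at e5
    rw [hx2] at e2 e4
    simp only [smul_eq_mul, anglePart_apply] at e1 e2 e3 e4 e5 ⊢
    rw [e6]
    have hεi := (hε i).ne'
    field_simp
    -- Both sides are compared at the mixed point y: the left is evaluated at (q, p), the right at
    -- (Q, P), whence the minus signs of `e2` and `e4`.
    linear_combination e5 + ε i * e1 - ε i * e2 + δ i * e3 - δ i * e4 + δ i * e7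
  refine ⟨_, fun i x => _, hΦ, heq, hG.comp (hΘ.of_le (Nat.le_succ n)) hmaps, ?_⟩
  -- Since δε ≠ 0, the identity just proved determines f', which is therefore periodic like all the
  -- other terms.
  intro i x hx k
  have h1 := heq i x hx
  have h2 := heq i _ (add_latticeVec_mem hx k)
  have hmem : oldCoords (δ i) (generator n (h i) (f i)) (Θ i x) ∈ torusTimes (U i) :=
    mem_torusTimes_of_near (hVU i) hx
      (((hΦ i).norm_sub_le x hx).trans (by linarith [hδM0 i]))
  have h3 : oldCoords (δ i) (generator n (h i) (f i)) (Θ i (x + latticeVec k))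
      = oldCoords (δ i) (generator n (h i) (f i)) (Θ i x) + latticeVec k :=
    (hΦ i).equivariant x hx k
  rw [h3, latticeVec_fst_snd, latticeVec_fst_snd, hgp i _ hmem k, hfp i _ hmem k,
    hgp i x (hsubT i hx) k, isPeriodic_average (hfp i) x (hsubT i hx) k, h1] at h2
  exact (mul_left_cancel₀ (mul_pos (hδ i) (hε i)).ne' (add_left_cancel h2)).symm

end TwoStepNormalForm

/-! ### From coordinate norms on closed sets to operator norms on open ones, and back. -/

namespace TwoStepNormalForm

section Norms

variable {E κ : Type} [NormedAddCommGroup E] [NormedSpace ℝ E] [Fintype κ]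

/-- A multilinear form bounded on a basis, with coordinates of norm at most one, is bounded. -/
theorem norm_multilinear_le_of_basis (e : κ → E) (c : κ → E → ℝ) (hc : ∀ k v, |c k v| ≤ ‖v‖)
    (hsum : ∀ v, ∑ k, c k v • e k = v) {m : ℕ}
    (T : ContinuousMultilinearMap ℝ (fun _ : Fin m => E) ℝ)
    {B : ℝ} (hT : ∀ j : Fin m → κ, |T fun i => e (j i)| ≤ B) :
    ‖T‖ ≤ (Fintype.card κ : ℝ) ^ m * |B| := by
  classical
  refine ContinuousMultilinearMap.opNorm_le_bound (by positivity) fun v => ?_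
  have h1 : T v = ∑ j : Fin m → κ, (∏ i, c (j i) (v i)) * T fun i => e (j i) := by
    conv_lhs => rw [← funext fun i => hsum (v i)]
    rw [T.map_sum]
    exact Finset.sum_congr rfl fun j _ => T.map_smul_univ (fun i => c (j i) (v i)) _
  rw [h1]
  refine (norm_sum_le _ _).trans ((Finset.sum_le_card_nsmul _ _ (|B| * ∏ i, ‖v i‖)
    fun j _ => ?_).trans (le_of_eq ?_))
  · rw [norm_mul, Real.norm_eq_abs, Real.norm_eq_abs, Finset.abs_prod, mul_comm]
    exact mul_le_mul ((hT j).trans (le_abs_self B))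
      (Finset.prod_le_prod (fun i _ => abs_nonneg _) fun i _ => hc _ _)
      (Finset.prod_nonneg fun i _ => abs_nonneg _) (abs_nonneg _)
  · simp [mul_assoc]

theorem norm_le_of_cNorm_le (e : κ → E) (c : κ → E → ℝ) (hc : ∀ k v, |c k v| ≤ ‖v‖)
    (hsum : ∀ v, ∑ k, c k v • e k = v) {n : ℕ} {s : Set E} {f : E → ℝ} {B : ℝ} (hB : 0 ≤ B)
    (h : cNorm e n s f ≤ ENNReal.ofReal B) {m : ℕ} (hm : m ≤ n) {x : E} (hx : x ∈ s) :
    ‖iteratedFDerivWithin ℝ m f s x‖ ≤ (Fintype.card κ : ℝ) ^ m * B := by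
  have h1 := norm_multilinear_le_of_basis e c hc hsum (iteratedFDerivWithin ℝ m f s x) (B := B)
    fun j => ?_
  · rwa [abs_of_nonneg hB] at h1
  · have h2 : ‖iteratedFDerivWithin ℝ m f s x fun i => e (j i)‖ₑ ≤ ENNReal.ofReal B := by
      refine le_trans ?_ h
      exact le_iSup_of_le m (le_iSup_of_le hm (le_iSup_of_le j (le_iSup_of_le x
        (le_iSup_of_le hx le_rfl))))
    rw [← ofReal_norm, ENNReal.ofReal_le_ofReal_iff hB] at h2
    exact h2

theorem unifCn_of_cNorm_le {ι : Type} (e : κ → E) (c : κ → E → ℝ) (hc : ∀ k v, |c k v| ≤ ‖v‖)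
    (hsum : ∀ v, ∑ k, c k v • e k = v) {n : ℕ} {s : Set E} {f : ι → E → ℝ} {B : ℝ} (hB : 0 ≤ B)
    {U : ι → Set E} (hU : ∀ i, IsOpen (U i)) (hUs : ∀ i, U i ⊆ s)
    (hf : ∀ i, ContDiffOn ℝ n (f i) s) (h : ∀ i, cNorm e n s (f i) ≤ ENNReal.ofReal B) :
    UnifCn n U f := by
  refine ⟨hU, fun i => (hf i).mono (hUs i), ((Fintype.card κ : ℝ) + 1) ^ n * B,
    fun i m hm x hx => ?_⟩
  have hset : U i =ᶠ[nhds x] s := by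
    filter_upwards [(hU i).mem_nhds hx] with y hy
    exact propext ⟨fun _ => hUs i hy, fun _ => hy⟩
  rw [iteratedFDerivWithin_congr_set hset]
  refine (norm_le_of_cNorm_le e c hc hsum hB (h i) hm (hUs i hx)).trans ?_
  refine mul_le_mul_of_nonneg_right ?_ hB
  calc (Fintype.card κ : ℝ) ^ m ≤ ((Fintype.card κ : ℝ) + 1) ^ m := by
        gcongr
        linarith
    _ ≤ ((Fintype.card κ : ℝ) + 1) ^ n := by
        gcongr
        exact le_add_of_nonneg_left (Nat.cast_nonneg _)

theorem unifCn_of_isActionCn {ι : Type} {n : ℕ} {S : Set ActionSpace} {h : ι → ActionSpace → ℝ}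
    {U : ι → Set ActionSpace} (hU : ∀ i, IsOpen (U i)) (hUS : ∀ i, U i ⊆ S)
    (hh : ∀ i, IsActionCn n S 1 (h i)) : UnifCn n U h := by
  refine unifCn_of_cNorm_le actionBasis (fun k v => v k) (fun k v => norm_le_pi_norm v k)
    (fun v => ?_) zero_le_one hU hUS (fun i => (hh i).1) fun i => (hh i).2
  ext k
  fin_cases k <;> simp [actionBasis]

theorem unifCn_of_isPhaseCn {ι : Type} {n : ℕ} {S : Set ActionSpace} {f : ι → PhaseSpace → ℝ}
    {U : ι → Set ActionSpace} (hU : ∀ i, IsOpen (U i)) (hUS : ∀ i, U i ⊆ S)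
    (hf : ∀ i, IsPhaseCn n S 1 (f i)) : UnifCn n (fun i => torusTimes (U i)) f := by
  refine unifCn_of_cNorm_le phaseBasis (fun k v => Sum.elim v.1 v.2 k) (fun k v => ?_)
    (fun v => ?_) zero_le_one (fun i => isOpen_univ.prod (hU i))
    (fun i => Set.prod_mono le_rfl (hUS i)) (fun i => (hf i).2.1) fun i => (hf i).2.2
  · cases k with
    | inl k => exact (norm_le_pi_norm v.1 k).trans (norm_fst_le v)
    | inr k => exact (norm_le_pi_norm v.2 k).trans (norm_snd_le v)
  · ext k <;> fin_cases k <;> simp [phaseBasis]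

theorem UnifCn.exists_isPhaseCn {ι : Type} {n : ℕ} {V S : ι → Set ActionSpace}
    {f : ι → PhaseSpace → ℝ} (hf : UnifCn n (fun i => torusTimes (V i)) f)
    (hp : ∀ i, IsPeriodic (V i) (f i)) (hSV : ∀ i, S i ⊆ V i) (hS : ∀ i, UniqueDiffOn ℝ (S i)) :
    ∃ C, ∀ i, IsPhaseCn n (S i) C (f i) := by
  obtain ⟨M, hM⟩ := hf.bound
  have hsub : ∀ i, torusTimes (S i) ⊆ torusTimes (V i) := fun i => Set.prod_mono le_rfl (hSV i)
  refine ⟨M, fun i => ⟨fun x hx => hp i x (hsub i hx), (hf.contDiffOn i).mono (hsub i), ?_⟩⟩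
  refine iSup_le fun m => iSup_le fun hm => iSup_le fun j => iSup_le fun x => iSup_le fun hx => ?_
  rw [iteratedFDerivWithin_subset (hsub i) (uniqueDiffOn_univ.prod (hS i))
    (hf.isOpen i).uniqueDiffOn ((hf.contDiffOn i).of_le (by exact_mod_cast hm)) hx,
    ← ofReal_norm]
  refine ENNReal.ofReal_le_ofReal (le_trans ?_ (hM i m hm x (hsub i hx)))
  refine (ContinuousMultilinearMap.le_opNorm _ _).trans (le_of_eq ?_)
  simp [norm_phaseBasis]

theorem IsPhaseCn.mono {n : ℕ} {S : Set ActionSpace} {C C' : ℝ} {f : PhaseSpace → ℝ}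
    (hf : IsPhaseCn n S C f) (h : C ≤ C') : IsPhaseCn n S C' f :=
  ⟨hf.1, hf.2.1, hf.2.2.trans (ENNReal.ofReal_le_ofReal h)⟩

end Norms

/-! ### Neighbourhoods of the segment. -/

section Geometry

variable {a b ρ ρ' d : ℝ}

/-- The open `ρ`-neighbourhood of the segment. -/
def openSegmentNhd (a b ρ : ℝ) : Set ActionSpace := Metric.thickening ρ (actionSegment a b)

theorem isOpen_openSegmentNhd : IsOpen (openSegmentNhd a b ρ) := Metric.isOpen_thickening

theorem convex_actionSegment : Convex ℝ (actionSegment a b) := by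
  intro x hx y hy s t hs ht hst
  refine ⟨?_, by simp [hx.2, hy.2]⟩
  exact convex_Icc a b hx.1 hy.1 hs ht hst

theorem convex_openSegmentNhd : Convex ℝ (openSegmentNhd a b ρ) :=
  convex_actionSegment.thickening ρ

theorem mem_actionSegment {s : ℝ} (hs : s ∈ Set.Icc a b) : ![s, 0] ∈ actionSegment a b :=
  ⟨by simpa using hs, by simp⟩

theorem mem_openSegmentNhd_of_mem_Icc (hρ : 0 < ρ) {s : ℝ} (hs : s ∈ Set.Icc a b) :
    ![s, 0] ∈ openSegmentNhd a b ρ :=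
  Metric.self_subset_thickening hρ _ (mem_actionSegment hs)

theorem openSegmentNhd_subset : openSegmentNhd a b ρ ⊆ segmentNhd a b ρ :=
  Metric.thickening_subset_cthickening ρ _

theorem segmentNhd_subset_openSegmentNhd (hρ' : 0 < ρ') (h : ρ < ρ') :
    segmentNhd a b ρ ⊆ openSegmentNhd a b ρ' :=
  Metric.cthickening_subset_thickening' hρ' h _

theorem mem_openSegmentNhd_of_near (h : ρ + d ≤ ρ') {P P' : ActionSpace}
    (hP : P ∈ openSegmentNhd a b ρ) (hd : ‖P' - P‖ ≤ d) : P' ∈ openSegmentNhd a b ρ' := by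
  obtain ⟨z, hz, hzP⟩ := Metric.mem_thickening_iff.1 hP
  refine Metric.mem_thickening_iff.2 ⟨z, hz, ?_⟩
  have := dist_triangle P' P z
  rw [dist_eq_norm P' P] at this
  linarith

theorem mem_segmentNhd_of_near (hρ : 0 ≤ ρ) (hd0 : 0 ≤ d) (h : ρ + d ≤ ρ') {P P' : ActionSpace}
    (hP : P ∈ segmentNhd a b ρ) (hd : ‖P' - P‖ ≤ d) : P' ∈ segmentNhd a b ρ' := by
  refine Metric.cthickening_mono ((add_comm d ρ).le.trans h) _ ?_
  refine Metric.cthickening_cthickening_subset hd0 hρ _ ?_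
  exact Metric.mem_cthickening_of_dist_le P' P d _ hP (by rwa [dist_eq_norm])

theorem uniqueDiffOn_segmentNhd (hab : a ≤ b) (hρ : 0 < ρ) :
    UniqueDiffOn ℝ (segmentNhd a b ρ) := by
  refine uniqueDiffOn_convex (convex_actionSegment.cthickening ρ) ⟨![a, 0], ?_⟩
  exact interior_maximal openSegmentNhd_subset isOpen_openSegmentNhd
    (mem_openSegmentNhd_of_mem_Icc hρ (Set.left_mem_Icc.2 hab))

theorem norm_actionBasis (k : Fin 2) : ‖actionBasis k‖ = 1 := by
  simp [actionBasis, Pi.norm_single]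

/-- The frequencies near the segment are close to those on it. -/
theorem exists_freq_near {h : ActionSpace → ℝ} {M : ℝ}
    (hd : ∀ I ∈ openSegmentNhd a b ρ, DifferentiableAt ℝ (fderiv ℝ h) I)
    (hM : ∀ I ∈ openSegmentNhd a b ρ, ‖fderiv ℝ (fderiv ℝ h) I‖ ≤ M) (hM0 : 0 ≤ M)
    {I : ActionSpace} (hI : I ∈ openSegmentNhd a b ρ) :
    ∃ s ∈ Set.Icc a b, ∀ k, |freq h k I - freq h k ![s, 0]| ≤ M * ρ := by
  obtain ⟨z, hz, hzI⟩ := Metric.mem_thickening_iff.1 hI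
  have hzeq : z = ![z 0, 0] := by
    ext k
    fin_cases k
    · simp
    · simpa using hz.2
  refine ⟨z 0, hz.1, fun k => ?_⟩
  rw [← hzeq]
  have hρ : 0 < ρ := dist_nonneg.trans_lt hzI
  have h1 := convex_openSegmentNhd.norm_image_sub_le_of_norm_fderiv_le hd hM
    (Metric.self_subset_thickening hρ _ hz) hI
  have h2 := (fderiv ℝ h I - fderiv ℝ h z).le_opNorm (actionBasis k)
  rw [norm_actionBasis, mul_one] at h2
  refine (h2.trans h1).trans ?_
  rw [← dist_eq_norm]
  gcongr

end Geometry

end TwoStepNormalForm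

/-! ### The two steps and the choice of constants. -/

namespace TwoStepNormalForm

/-- The data of the normal form theorem, with the radius `ρ` of the neighbourhood in place of the
size of the perturbation. -/
structure SegmentData (r l : ℕ) (R ϖ : ℝ) where
  /-- the integrable part -/
  h : ActionSpace → ℝ
  /-- the perturbation -/
  f : PhaseSpace → ℝ
  /-- the left endpoint of the segment -/
  a : ℝ
  /-- the right endpoint of the segment -/
  b : ℝ
  /-- the radius of the neighbourhood -/
  ρ : ℝ
  radius_pos : 0 < ρ
  le : a ≤ b
  isActionCn : IsActionCn (l + 3) (actionBall R) 1 h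
  isPhaseCn : IsPhaseCn r (actionBall R) 1 f
  subset : segmentNhd a b ρ ⊆ actionBall R
  slow : ∀ s ∈ Set.Icc a b, freq h 0 ![s, 0] = 0
  fast : ∀ s ∈ Set.Icc a b, ϖ ≤ freq h 1 ![s, 0]

variable {r l l' : ℕ} {R ϖ : ℝ}

namespace SegmentData

/-- The concentric neighbourhoods of the segment, as multiples of the given radius. -/
abbrev nhd (d : SegmentData r l R ϖ) (t : ℝ) : Set ActionSpace := openSegmentNhd d.a d.b (t * d.ρ)

theorem nhd_one_subset (d : SegmentData r l R ϖ) : d.nhd 1 ⊆ actionBall R := by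
  rw [nhd, one_mul]
  exact openSegmentNhd_subset.trans d.subset

theorem unifCn_h : UnifCn (l + 3) (fun d : SegmentData r l R ϖ => d.nhd 1) fun d => d.h :=
  unifCn_of_isActionCn (fun _ => isOpen_openSegmentNhd) nhd_one_subset fun d => d.isActionCn

theorem unifCn_f :
    UnifCn r (fun d : SegmentData r l R ϖ => torusTimes (d.nhd 1)) fun d => d.f :=
  unifCn_of_isPhaseCn (fun _ => isOpen_openSegmentNhd) nhd_one_subset fun d => d.isPhaseCn

theorem isPeriodic_f (d : SegmentData r l R ϖ) : IsPeriodic (d.nhd 1) d.f := fun x hx k =>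
  d.isPhaseCn.1 x ⟨trivial, d.nhd_one_subset hx.2⟩ k

/-- The frequencies differ by O(ρ) from their values on the segment, as the Hessian of h is
uniformly bounded. The conditions on the segment are used here only. -/
theorem exists_freq_bounds (r l : ℕ) (R ϖ : ℝ) : ∃ B > 0, ∀ d : SegmentData r l R ϖ,
    ∀ I ∈ d.nhd 1, |freq d.h 0 I| ≤ B * d.ρ ∧ ϖ - B * d.ρ ≤ freq d.h 1 I := by
  have hh := unifCn_h (r := r) (l := l) (R := R) (ϖ := ϖ)
  obtain ⟨B, hB0, hB⟩ := hh.derivative.derivative.norm_le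
  refine ⟨B, hB0, fun d I hI => ?_⟩
  obtain ⟨s, hs, hfreq⟩ := exists_freq_near (fun J hJ => hh.derivative.differentiableAt hJ)
    (hB d) hB0.le hI
  rw [one_mul] at hfreq
  have h0 := hfreq 0
  have h1 := (abs_le.1 (hfreq 1)).1
  rw [d.slow s hs, sub_zero] at h0
  exact ⟨h0, by linarith [d.fast s hs]⟩

end SegmentData

theorem UnifCn.exists_derivative_bounds {ι E F : Type} [NormedAddCommGroup E] [NormedSpace ℝ E]
    [NormedAddCommGroup F] [NormedSpace ℝ F] {n : ℕ} {U : ι → Set E} {f : ι → E → F}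
    (hf : UnifCn (n + 2) U f) : ∃ M > 0, ∀ i, ∀ x ∈ U i,
      ‖fderiv ℝ (f i) x‖ ≤ M ∧ ‖fderiv ℝ (fderiv ℝ (f i)) x‖ ≤ M := by
  obtain ⟨A, hA0, hA⟩ := hf.derivative.norm_le
  obtain ⟨B, hB0, hB⟩ := hf.derivative.derivative.norm_le
  exact ⟨max A B, lt_max_of_lt_left hA0, fun i x hx =>
    ⟨(hA i x hx).trans (le_max_left _ _), (hB i x hx).trans (le_max_right _ _)⟩⟩

/-- The conclusion of the normal form theorem. -/
def HasTwoStepNormalForm (l l' : ℕ) (h : ActionSpace → ℝ) (f : PhaseSpace → ℝ)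
    (a b κ ε C : ℝ) : Prop :=
  ∃ (Φ₁ : PhaseSpace → PhaseSpace) (f' : PhaseSpace → ℝ),
    IsSymplecticEmbedding (l + 1) (segmentNhd a b (κ * ε / 2)) (segmentNhd a b (κ * ε)) Φ₁ ∧
    IsCloseToId (segmentNhd a b (κ * ε / 2)) (κ * ε / 2) Φ₁ ∧
    (∀ x ∈ torusTimes (segmentNhd a b (κ * ε / 2)),
      hamiltonian h ε f (Φ₁ x) = h x.2 + ε * average f x + ε ^ 2 * f' x) ∧
    IsPhaseCn l (segmentNhd a b (κ * ε / 2)) C f' ∧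
    ∃ (Φ : PhaseSpace → PhaseSpace) (f'' : PhaseSpace → ℝ),
      IsSymplecticEmbedding (l' + 1) (segmentNhd a b (κ * ε / 4)) (segmentNhd a b (κ * ε)) Φ ∧
      IsCloseToId (segmentNhd a b (κ * ε / 4)) (3 * κ * ε / 4) Φ ∧
      (∀ x ∈ torusTimes (segmentNhd a b (κ * ε / 4)),
        hamiltonian h ε f (Φ x)
          = h x.2 + ε * average f x + ε ^ 2 * average f' x + ε ^ 3 * f'' x) ∧
      IsPhaseCn l' (segmentNhd a b (κ * ε / 4)) C f''

theorem HasTwoStepNormalForm.mono {h : ActionSpace → ℝ} {f : PhaseSpace → ℝ}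
    {a b κ ε C C' : ℝ} (H : HasTwoStepNormalForm l l' h f a b κ ε C) (hC : C ≤ C') :
    HasTwoStepNormalForm l l' h f a b κ ε C' := by
  obtain ⟨Φ₁, f', h1, h2, h3, h4, Φ, f'', h5, h6, h7, h8⟩ := H
  exact ⟨Φ₁, f', h1, h2, h3, h4.mono hC, Φ, f'', h5, h6, h7, h8.mono hC⟩

/-- Every large κ is admitted, not one particular value, because a single κ must later serve all l
and l'. -/
theorem exists_twoStepNormalForm (hϖ : 0 < ϖ) (hl : 2 * (l + 1) + 3 ≤ r)
    (hl' : 2 * (l' + 1) + 3 ≤ l) :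
    ∃ κ₀ > 0, ∀ κ ≥ κ₀, ∃ ε₀ > 0, ∃ C > 0, ∀ d : SegmentData r l R ϖ, ∀ ε : ℝ, 0 < ε → ε ≤ ε₀ →
      d.ρ = κ * ε → HasTwoStepNormalForm l l' d.h d.f d.a d.b κ ε C := by
  obtain ⟨B, hB0, hB⟩ := SegmentData.exists_freq_bounds r l R ϖ
  -- a first family, on which the fast frequency is bounded from below
  let ι₀ := {d : SegmentData r l R ϖ // B * d.ρ ≤ ϖ / 2}
  have hω : ∀ i : ι₀, ∀ I ∈ i.1.nhd 1, ϖ / 2 ≤ freq i.1.h 1 I := fun i I hI => by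
    linarith [(hB i.1 I hI).2, i.2]
  have hh₀ := (SegmentData.unifCn_h (r := r) (l := l) (R := R) (ϖ := ϖ)).reindex
    (Subtype.val : ι₀ → _)
  have hf₀ := (SegmentData.unifCn_f (r := r) (l := l) (R := R) (ϖ := ϖ)).reindex
    (Subtype.val : ι₀ → _)
  obtain ⟨M, hM0, hM⟩ := (unifCn_generator (N := l + 2) (n := l) hh₀ (half_pos hϖ) hω
    (hf₀.of_le (by omega))).exists_derivative_bounds
  -- With κ ≥ 16 M one has 4 ε M ≤ ρ/4, the gap between the radii 3ρ/4 and ρ. No circularity arises,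
  -- as M was found before κ.
  refine ⟨16 * M, by positivity, fun κ hκ => ?_⟩
  have hκ0 : 0 < κ := lt_of_lt_of_le (by positivity) hκ
  -- the family for the first step
  let ι₁ := {p : ι₀ × ℝ // 0 < p.2 ∧ p.2 ≤ min 1 (1 / (2 * M)) ∧ p.1.1.ρ = κ * p.2}
  let d : ι₁ → SegmentData r l R ϖ := fun i => i.1.1.1
  let e : ι₁ → ℝ := fun i => i.1.2
  have he0 : ∀ i, 0 < e i := fun i => i.2.1
  have he1 : ∀ i, e i ≤ 1 := fun i => i.2.2.1.trans (min_le_left _ _)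
  have heM : ∀ i, e i * M ≤ 1 / 2 := fun i => by
    have h := i.2.2.1.trans (min_le_right _ _)
    rw [le_div_iff₀ (by positivity)] at h
    show i.1.2 * M ≤ 1 / 2
    linarith
  have hρ : ∀ i, (d i).ρ = κ * e i := fun i => i.2.2.2
  have hMκ : ∀ i, 16 * (e i * M) ≤ (d i).ρ := fun i => by
    rw [hρ i]
    nlinarith [he0 i]
  have hω1 : ∀ i, ∀ I ∈ (d i).nhd 1, ϖ / 2 ≤ freq (d i).h 1 I := fun i => hω i.1.1
  have hω0 : ∀ i, ∀ I ∈ (d i).nhd 1, |freq (d i).h 0 I| ≤ B * κ * e i := fun i I hI => by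
    rw [mul_assoc, ← hρ i]
    exact (hB _ I hI).1
  have hh₁ : UnifCn (l + 3) (fun i => (d i).nhd 1) fun i => (d i).h :=
    SegmentData.unifCn_h.reindex d
  have hf₁ : UnifCn r (fun i => torusTimes ((d i).nhd 1)) fun i => (d i).f :=
    SegmentData.unifCn_f.reindex d
  obtain ⟨Φ₁, f', hΦ₁, heq₁, hf', hf'p⟩ := exists_normalForm_step (n := l)
    (U := fun i => (d i).nhd 1) (V := fun i => (d i).nhd (3 / 4)) (h := fun i => (d i).h)
    (f := fun i => (d i).f) (g := fun _ _ => 0) (ε := e) (δ := e) (c' := B * κ) (M := M)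
    hh₁ (half_pos hϖ) hω1 he0 he1 he0 (fun _ => le_rfl) hω0 (hf₁.of_le (by omega))
    (fun i => (d i).isPeriodic_f)
    (UnifCn.const (c := fun _ => (0 : ℝ)) (M := 0) hf₁.isOpen (by simp)) (fun _ _ _ _ => rfl)
    (fun _ => convex_openSegmentNhd) (fun _ => isOpen_openSegmentNhd) hM0.le
    (fun i x hx => (hM i.1.1 x hx).1) (fun i x hx => (hM i.1.1 x hx).2) heM
    (fun i P hP P' hP' => mem_openSegmentNhd_of_near (by linarith [hMκ i]) hP hP')
  have hsub : ∀ i, (d i).nhd (3 / 4) ⊆ (d i).nhd 1 := fun i P hP =>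
    mem_openSegmentNhd_of_near (d := 0) (by linarith [(d i).radius_pos]) hP (by simp)
  have hsubT : ∀ i, torusTimes ((d i).nhd (3 / 4)) ⊆ torusTimes ((d i).nhd 1) := fun i =>
    Set.prod_mono le_rfl (hsub i)
  have hh₂ := hh₁.mono_set (V := fun i => (d i).nhd (3 / 4)) (fun _ => isOpen_openSegmentNhd) hsub
  have havg := (unifCn_average hf₁ fun i => (d i).isPeriodic_f).mono_set
    (V := fun i => torusTimes ((d i).nhd (3 / 4))) hf'.isOpen hsubT
  have havgp : ∀ i, IsPeriodic ((d i).nhd (3 / 4)) (average (d i).f) := fun i x hx k =>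
    isPeriodic_average (d i).isPeriodic_f x (hsubT i hx) k
  have hω1' : ∀ i, ∀ I ∈ (d i).nhd (3 / 4), ϖ / 2 ≤ freq (d i).h 1 I := fun i I hI =>
    hω1 i I (hsub i hI)
  -- M' depends on κ through f'. This is harmless: the second displacement is ε² M', which is beaten
  -- by κε for small ε.
  obtain ⟨M', hM'0, hM'⟩ := (unifCn_generator (N := l' + 2) (n := l')
    (hh₂.of_le (by omega : l' + 2 + 1 ≤ l + 3)) (half_pos hϖ) hω1'
    (hf'.of_le (by omega))).exists_derivative_bounds
  obtain ⟨C₁, hC₁⟩ := hf'.exists_isPhaseCn hf'p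
    (S := fun i => segmentNhd (d i).a (d i).b (κ * e i / 2)) (fun i => by
      have hpos := (d i).radius_pos
      rw [← hρ i]
      exact segmentNhd_subset_openSegmentNhd (by positivity) (by linarith))
    (fun i => uniqueDiffOn_segmentNhd (d i).le (by
      have := he0 i
      positivity))
  -- the family for the second step
  let ι₂ := {i : ι₁ // e i ≤ min (1 / (2 * M')) (κ / (16 * M'))}
  have heM' : ∀ i : ι₂, e i.1 ^ 2 * M' ≤ 1 / 2 := fun i => by
    have h := i.2.trans (min_le_left _ _)
    rw [le_div_iff₀ (by positivity)] at h
    nlinarith [he0 i.1, he1 i.1]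
  have hMκ' : ∀ i : ι₂, 16 * (e i.1 ^ 2 * M') ≤ (d i.1).ρ := fun i => by
    have h := i.2.trans (min_le_right _ _)
    rw [le_div_iff₀ (by positivity)] at h
    rw [hρ i.1]
    nlinarith [he0 i.1]
  -- With δ = ε² the new remainder has size δε = ε³, including the change of the averaged term ε f̄.
  -- The radius drops from 3ρ/4 to ρ/2.
  obtain ⟨Φ₂, f'', hΦ₂, heq₂, hf'', hf''p⟩ := exists_normalForm_step (n := l')
    (U := fun i : ι₂ => (d i.1).nhd (3 / 4)) (V := fun i => (d i.1).nhd (1 / 2))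
    (h := fun i => (d i.1).h) (f := fun i => f' i.1) (g := fun i => average (d i.1).f)
    (ε := fun i => e i.1) (δ := fun i => e i.1 ^ 2) (c' := B * κ) (M := M')
    ((hh₂.of_le (by omega : l' + 3 ≤ l + 3)).reindex Subtype.val) (half_pos hϖ)
    (fun i => hω1' i.1) (fun i => he0 i.1) (fun i => he1 i.1) (fun i => pow_pos (he0 i.1) 2)
    (fun i => by nlinarith [he0 i.1, he1 i.1]) (fun i I hI => hω0 i.1 I (hsub i.1 hI))
    ((hf'.of_le (by omega : 2 * l' + 3 ≤ l)).reindex Subtype.val) (fun i => hf'p i.1)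
    ((havg.of_le (by omega : l' + 1 ≤ r)).reindex Subtype.val) (fun i => havgp i.1)
    (fun _ => convex_openSegmentNhd) (fun _ => isOpen_openSegmentNhd) hM'0.le
    (fun i x hx => (hM' i.1 x hx).1) (fun i x hx => (hM' i.1 x hx).2) heM'
    (fun i P hP P' hP' => mem_openSegmentNhd_of_near (by linarith [hMκ' i]) hP hP')
  obtain ⟨C₂, hC₂⟩ := hf''.exists_isPhaseCn hf''p
    (S := fun i => segmentNhd (d i.1).a (d i.1).b (κ * e i.1 / 4)) (fun i => by
      have hpos := (d i.1).radius_pos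
      rw [← hρ i.1]
      exact segmentNhd_subset_openSegmentNhd (by positivity) (by linarith))
    (fun i => uniqueDiffOn_segmentNhd (d i.1).le (by
      have := he0 i.1
      positivity))
  -- In order: ε ≤ 1, contraction in the first step, contraction in the second, room for the second
  -- displacement, and B ρ ≤ ϖ/2, which keeps ω₂ ≥ ϖ/2.
  refine ⟨min (min (min 1 (1 / (2 * M))) (min (1 / (2 * M')) (κ / (16 * M')))) (ϖ / (2 * B * κ)),
    by positivity, max 1 (max C₁ C₂), by positivity, fun D ε hε hεle hDρ => ?_⟩
  rw [le_min_iff, le_min_iff] at hεle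
  have hDB : B * D.ρ ≤ ϖ / 2 := by
    have h := hεle.2
    rw [le_div_iff₀ (by positivity)] at h
    rw [hDρ]
    linarith
  let i : ι₂ := ⟨⟨(⟨D, hDB⟩, ε), hε, hεle.1.1, hDρ⟩, hεle.1.2⟩
  have hpos := D.radius_pos
  have hMi : 16 * (ε * M) ≤ D.ρ := hMκ i.1
  have hMi' : 16 * (ε ^ 2 * M') ≤ D.ρ := hMκ' i
  have hΦ₁i : IsNearIdSymplectic (l + 1) (D.nhd (3 / 4)) (ε * M) (Φ₁ i.1) := hΦ₁ i.1
  have hΦ₂i : IsNearIdSymplectic (l' + 1) (D.nhd (1 / 2)) (ε ^ 2 * M') (Φ₂ i) := hΦ₂ i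
  have hεM : 0 ≤ ε * M := by positivity
  have hεM' : 0 ≤ ε ^ 2 * M' := by positivity
  have hmap : ∀ P ∈ D.nhd (1 / 2), ∀ P', ‖P' - P‖ ≤ ε ^ 2 * M' → P' ∈ D.nhd (3 / 4) :=
    fun P hP P' hP' => mem_openSegmentNhd_of_near (by linarith) hP hP'
  have hcomp := hΦ₁i.comp (by omega) hΦ₂i isOpen_openSegmentNhd isOpen_openSegmentNhd hmap
  have hs1 : segmentNhd D.a D.b (κ * ε / 2) ⊆ D.nhd (3 / 4) := by
    rw [← hDρ]
    exact segmentNhd_subset_openSegmentNhd (by positivity) (by linarith)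
  have hs2 : segmentNhd D.a D.b (κ * ε / 4) ⊆ D.nhd (1 / 2) := by
    rw [← hDρ]
    exact segmentNhd_subset_openSegmentNhd (by positivity) (by linarith)
  refine ⟨Φ₁ i.1, f' i.1, hΦ₁i.isSymplecticEmbedding isOpen_openSegmentNhd hs1
      (uniqueDiffOn_segmentNhd D.le (by positivity)) (fun P hP P' hP' =>
        mem_segmentNhd_of_near (by positivity) hεM (by linarith) hP hP'), ?_, ?_,
    (hC₁ i.1).mono ((le_max_left _ _).trans (le_max_right _ _)),
    Φ₁ i.1 ∘ Φ₂ i, f'' i, hcomp.isSymplecticEmbedding isOpen_openSegmentNhd hs2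
      (uniqueDiffOn_segmentNhd D.le (by positivity)) (fun P hP P' hP' =>
        mem_segmentNhd_of_near (by positivity) (add_nonneg hεM hεM') (by linarith) hP hP'),
    ?_, ?_, (hC₂ i).mono ((le_max_right _ _).trans (le_max_right _ _))⟩
  · exact fun x hx => (hΦ₁i.norm_sub_le x ⟨trivial, hs1 hx.2⟩).trans (by linarith)
  · intro x hx
    have h : D.h (Φ₁ i.1 x).2 + ε * 0 + ε * D.f (Φ₁ i.1 x)
        = D.h x.2 + ε * 0 + ε * average D.f x + ε * ε * f' i.1 x :=
      heq₁ i.1 x ⟨trivial, hs1 hx.2⟩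
    rw [hamiltonian]
    linear_combination h
  · exact fun x hx => (hcomp.norm_sub_le x ⟨trivial, hs2 hx.2⟩).trans (by linarith)
  · intro x hx
    have hx' : x ∈ torusTimes (D.nhd (1 / 2)) := ⟨trivial, hs2 hx.2⟩
    have h1 : D.h (Φ₁ i.1 (Φ₂ i x)).2 + ε * 0 + ε * D.f (Φ₁ i.1 (Φ₂ i x))
        = D.h (Φ₂ i x).2 + ε * 0 + ε * average D.f (Φ₂ i x) + ε * ε * f' i.1 (Φ₂ i x) :=
      heq₁ i.1 (Φ₂ i x) (mem_torusTimes_of_near hmap hx' (hΦ₂i.norm_sub_le x hx'))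
    have h2 : D.h (Φ₂ i x).2 + ε * average D.f (Φ₂ i x) + ε ^ 2 * f' i.1 (Φ₂ i x)
        = D.h x.2 + ε * average D.f x + ε ^ 2 * average (f' i.1) x + ε ^ 2 * ε * f'' i x :=
      heq₂ i x hx'
    rw [hamiltonian, Function.comp_apply]
    linear_combination h1 + h2

/-- On the segment, which lies in the interior of the ball, the frequency is an ordinary partial
derivative. -/
theorem frequency_eq_freq {h : ActionSpace → ℝ} {a b ρ s : ℝ} (hρ : 0 < ρ)
    (hsub : segmentNhd a b ρ ⊆ actionBall R) (hs : s ∈ Set.Icc a b) (k : Fin 2) :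
    frequency R h k ![s, 0] = freq h k ![s, 0] := by
  have hmem : actionBall R ∈ nhds ![s, 0] := Filter.mem_of_superset
    (isOpen_openSegmentNhd.mem_nhds (mem_openSegmentNhd_of_mem_Icc hρ hs))
    (openSegmentNhd_subset.trans hsub)
  rw [frequency, fderivWithin_of_mem_nhds hmem, freq]

/-- The constants can be chosen uniformly in the orders of differentiability. -/
theorem exists_uniform_constants (r : ℕ) (R : ℝ) (hϖ : 0 < ϖ) :
    ∃ κ > 0, ∃ ε₀ > 0, ∃ C > 0, ∀ l l' : ℕ, 2 * (l + 1) + 3 ≤ r → 2 * (l' + 1) + 3 ≤ l →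
      ∀ d : SegmentData r l R ϖ, ∀ ε : ℝ, 0 < ε → ε ≤ ε₀ →
        d.ρ = κ * ε → HasTwoStepNormalForm l l' d.h d.f d.a d.b κ ε C := by
  -- The inequalities force l, l' ≤ r, so only finitely many pairs occur; inadmissible pairs get the
  -- value 1.
  have hex : ∀ p : Fin (r + 1) × Fin (r + 1), ∃ κ₀ > 0, ∀ κ ≥ κ₀, ∃ ε₀ > 0, ∃ C > 0,
      2 * ((p.1 : ℕ) + 1) + 3 ≤ r → 2 * ((p.2 : ℕ) + 1) + 3 ≤ p.1 →
      ∀ d : SegmentData r p.1 R ϖ, ∀ ε : ℝ, 0 < ε → ε ≤ ε₀ →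
        d.ρ = κ * ε → HasTwoStepNormalForm p.1 p.2 d.h d.f d.a d.b κ ε C := by
    intro p
    by_cases h : 2 * ((p.1 : ℕ) + 1) + 3 ≤ r ∧ 2 * ((p.2 : ℕ) + 1) + 3 ≤ p.1
    · obtain ⟨κ₀, hκ₀, H⟩ := exists_twoStepNormalForm (R := R) hϖ h.1 h.2
      refine ⟨κ₀, hκ₀, fun κ hκ => ?_⟩
      obtain ⟨ε₀, hε₀, C, hC, H⟩ := H κ hκ
      exact ⟨ε₀, hε₀, C, hC, fun _ _ => H⟩
    · exact ⟨1, one_pos, fun _ _ => ⟨1, one_pos, 1, one_pos, fun h1 h2 => absurd ⟨h1, h2⟩ h⟩⟩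
  choose κ₀ hκ₀ H using hex
  -- The common κ is fixed first, because ε₀ and C depend on it.
  obtain ⟨pκ, hpκ⟩ := Finite.exists_max κ₀
  choose ε₀ hε₀ C hC H using fun p => H p (κ₀ pκ) (hpκ p)
  obtain ⟨pε, hpε⟩ := Finite.exists_min ε₀
  obtain ⟨pC, hpC⟩ := Finite.exists_max C
  refine ⟨κ₀ pκ, hκ₀ pκ, ε₀ pε, hε₀ pε, C pC, hC pC, fun l l' hl hl' d ε hε hεle hd => ?_⟩
  exact (H (⟨l, by omega⟩, ⟨l', by omega⟩) hl hl' d ε hε (hεle.trans (hpε _)) hd).mono (hpC _)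

end TwoStepNormalForm


/-! ### The theorem, with radius ρ = κε. -/

theorem mainTheorem4 (r : ℕ) (R L ϖ : ℝ) (hR : 0 < R) (hL : 0 ≤ L) (hϖ : 0 < ϖ) :
    -- the constants depend only on `r`, `R`, the length `L` of `S₁^*` and `ϖ`
    ∃ κ > 0, ∃ ε₀ > 0, ∃ C > 0,
      ∀ (l l' : ℕ), 1 ≤ l → 1 ≤ l' → 2 * (l + 1) + 3 ≤ r → 2 * (l' + 1) + 3 ≤ l →
      ∀ (h : ActionSpace → ℝ) (f : PhaseSpace → ℝ),
        IsActionCn (l + 3) (actionBall R) 1 h →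
        IsPhaseCn r (actionBall R) 1 f →
      -- the closed segments `S₁^* = [a, b] ⊆ S₁ = [a₁, b₁] ⊆ [-R, R]`
      ∀ a b a₁ b₁ : ℝ, a ≤ b → b - a = L →
        Set.Icc a b ⊆ Set.Icc a₁ b₁ → Set.Icc a₁ b₁ ⊆ Set.Icc (-R) R →
        (∀ I₁ ∈ Set.Icc a₁ b₁, frequency R h 0 ![I₁, 0] = 0) →
        (∀ I₁ ∈ Set.Icc a b, ϖ ≤ frequency R h 1 ![I₁, 0]) →
      ∀ ε : ℝ, 0 < ε → ε ≤ ε₀ → segmentNhd a b (κ * ε) ⊆ actionBall R →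
      -- the one-step normal form, which introduces `f'`
      ∃ (Φ₁ : PhaseSpace → PhaseSpace) (f' : PhaseSpace → ℝ),
        IsSymplecticEmbedding (l + 1) (segmentNhd a b (κ * ε / 2)) (segmentNhd a b (κ * ε)) Φ₁ ∧
        IsCloseToId (segmentNhd a b (κ * ε / 2)) (κ * ε / 2) Φ₁ ∧
        (∀ x ∈ torusTimes (segmentNhd a b (κ * ε / 2)),
          hamiltonian h ε f (Φ₁ x) = h x.2 + ε * average f x + ε ^ 2 * f' x) ∧
        IsPhaseCn l (segmentNhd a b (κ * ε / 2)) C f' ∧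
      -- the two-step normal form
      ∃ (Φ : PhaseSpace → PhaseSpace) (f'' : PhaseSpace → ℝ),
        IsSymplecticEmbedding (l' + 1) (segmentNhd a b (κ * ε / 4)) (segmentNhd a b (κ * ε)) Φ ∧
        IsCloseToId (segmentNhd a b (κ * ε / 4)) (3 * κ * ε / 4) Φ ∧
        (∀ x ∈ torusTimes (segmentNhd a b (κ * ε / 4)),
          hamiltonian h ε f (Φ x)
            = h x.2 + ε * average f x + ε ^ 2 * average f' x + ε ^ 3 * f'' x) ∧
        IsPhaseCn l' (segmentNhd a b (κ * ε / 4)) C f'' := by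

  obtain ⟨κ, hκ, ε₀, hε₀, C, hC, H⟩ := exists_uniform_constants r R hϖ
  refine ⟨κ, hκ, ε₀, hε₀, C, hC, fun l l' _ _ hl hl' h f hh hf a b a₁ b₁ hab _ hsub _ h0 h1 ε hε
    hεle hball => ?_⟩
  have hρ : 0 < κ * ε := mul_pos hκ hε
  exact H l l' hl hl'
    { h := h, f := f, a := a, b := b, ρ := κ * ε, radius_pos := hρ, le := hab
      isActionCn := hh, isPhaseCn := hf, subset := hball
      slow := fun s hs => by
        rw [← frequency_eq_freq hρ hball hs]
        exact h0 s (hsub hs)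
      fast := fun s hs => by
        rw [← frequency_eq_freq hρ hball hs]
        exact h1 s hs } ε hε hεle rfl
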